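/- Let $\Sigma=\{0,1\}$ and let $\Sigma^*=\bigcup_{m\ge 1}\Sigma^m$ be the set of non-empty finite words over $\Sigma$. A promise problem is a function $\phi$ that assigns to each $x\in\Sigma^*$ a non-empty subset $\phi(x)\subseteq\Sigma$ of valid answers; a function $\phi:\Sigma^*\to\Sigma$ is regarded as the promise problem $x\mapsto\{\phi(x)\}$. For promise problems, $\phi_1\propto\phi_2$ means that there is a polynomial-time computable $\mu:\Sigma^*\to\Sigma^*$ with $\phi_1(x)\supseteq\phi_2(\mu(x))$ for all $x$, and $[\phi_2]=\{\phi_1\mid\phi_1\propto\phi_2\}$. Further, $\phi_1\propto_T\phi_2$ means that there are a $\phi_2$-oracle Turing machine $M$ and a polynomial $p$ such that on every input $x\in\Sigma^*$ every possible path of $M$ halts within $p(|x|)$ steps and outputs an element of $\phi_1(x)$; here a query $w\in\Sigma^*$ takes one step and may be answered by any element of $\phi_2(w)$, independently of earlier answers. Put $\widehat{\mathrm P}^{\phi_2}=\{\phi_1\mid\phi_1\propto_T\phi_2\}$ and, for a class $X$ of promise problems, $\widehat{\mathrm P}^{X}=\bigcup_{\phi\in X}\widehat{\mathrm P}^{\phi}$.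 For $n\ge 1$, consider functions $f:\Sigma^{m_1}\times\cdots\times\Sigma^{m_n}\to\Sigma$ with $m_1,\dots,m_n\ge 1$, given (encoded as words) by $m_1,\dots,m_n$ in unary and a Boolean expression with the operators $\land,\lor,\lnot$. For $x\in\Sigma^{m_1}$ let $f_x$ be the function of the remaining $n-1$ arguments obtained by fixing the first argument to be $x$. Define $\mathrm{SAT}_n(f)=1$ iff $\exists x:\overline{\mathrm{SAT}}_{n-1}(f_x)=1$, and $\overline{\mathrm{SAT}}_n(f)=1$ iff $\forall x:\mathrm{SAT}_{n-1}(f_x)=1$, where for $n=0$ both are the value of $f$. Let $\mathrm{VAL}_n(f)$ be the set of the first letters $x_1$ of all $x\in\Sigma^{m_1}$ with $\overline{\mathrm{SAT}}_{n-1}(f_x)=1$ if $\mathrm{SAT}_n(f)=1$, and $\Sigma$ otherwise. On words that encode no such $f$, the value of $\mathrm{SAT}_n$ is $0$ and that of $\mathrm{VAL}_n$ is $\Sigma$. Put $\widehat{\mathrm V}_n=[\mathrm{VAL}_n]$ and $\widehat\Delta_{n+1}=\widehat{\mathrm P}^{\mathrm{SAT}_n}$. Theorem. For every $n\ge 1$,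 $\widehat{\mathrm P}^{\widehat{\mathrm V}_n}=\widehat\Delta_{n+1}$, and also $\widehat{\mathrm P}^{\mathrm{VAL}_n}=\widehat\Delta_{n+1}$. -/

import Mathlib

namespace PromiseHierarchy

/-! ### Words and promise problems -/

/-- `Σ*`: the non-empty finite words over the alphabet `{0,1}`. -/
abbrev Word : Type := {w : List Bool // w ≠ []}

/-- `P₊Σ`: the non-empty subsets of `{0,1}`. -/
abbrev PPlus : Type := {S : Set Bool // S.Nonempty}

/-- A (non-promise) problem `Σ* → Σ`. -/
abbrev Problem : Type := Word → Bool

/-- A promise problem `Σ* → P₊Σ`: to each word the set of its valid answers. -/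
abbrev PromiseProblem : Type := Word → PPlus

/-- A problem `φ` regarded as the promise problem `x ↦ {φ x}`. -/
def Problem.toPromise (φ : Problem) : PromiseProblem :=
  fun x => ⟨{φ x}, Set.singleton_nonempty _⟩

/-! ### Strong (many-one, Karp) reduction -/

/-- `φ₁ ∝ φ₂`: some polynomial-time computable `μ : Σ* → Σ*` has `φ₁ x ⊇ φ₂ (μ x)` for all `x`. -/
def StrongReduces (φ₁ φ₂ : PromiseProblem) : Prop :=
  ∃ μ : Word → Word,
    Nonempty (Turing.TM2ComputableInPolyTime
      (Subtype.val : Word → List Bool) (Subtype.val : Word → List Bool) μ) ∧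
    ∀ x : Word, (φ₂ (μ x) : Set Bool) ⊆ (φ₁ x : Set Bool)

/-- The strong closure `[φ₂] = {φ₁ | φ₁ ∝ φ₂}`. -/
def strongClosure (φ₂ : PromiseProblem) : Set PromiseProblem :=
  {φ₁ | StrongReduces φ₁ φ₂}

/-! ### Oracle Turing machines and weak (Turing, Cook) reduction -/

/-- An oracle Turing machine with input and output words over `{0,1}`: a Turing machine of the
kind that `Turing.TM2ComputableInPolyTime` is about, with one of its stacks serving as the query
stack, and with some of its labels being query labels. At a label `l` with `query l = some next`
the machine hands the word on the query stack to the oracle (the first letter of the word on top),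
receives an answer `b`, and continues at the label `next b` with the query stack emptied;
at a label `l` with `query l = none` it executes its statement `tm.m l`. -/
structure OracleTM extends Turing.TM2ComputableAux Bool Bool where
  /-- the stack from which the oracle reads the query -/
  queryStack : tm.K
  /-- the alphabet of the query stack is `{0,1}` -/
  queryAlphabet : tm.Γ queryStack ≃ Bool
  /-- the query labels, with the labels at which the machine continues after an answer -/
  query : tm.Λ → Option (Bool → tm.Λ)

namespace OracleTM

/-- One step of `M` with an oracle for the promise problem `φ`. A query of `w` takes unit time and
may be answered by any element of `φ w`, independently of earlier answers. There is no step from a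
query label when the query stack is empty, because the empty word is not in `Σ*`. -/
inductive Step (M : OracleTM) (φ : PromiseProblem) : M.tm.Cfg → M.tm.Cfg → Prop
  | compute (l : M.tm.Λ) (v : M.tm.σ) (S : ∀ k, List (M.tm.Γ k)) (h : M.query l = none) :
      Step M φ ⟨some l, v, S⟩ (Turing.TM2.stepAux (M.tm.m l) v S)
  | ask (l : M.tm.Λ) (v : M.tm.σ) (S : ∀ k, List (M.tm.Γ k)) (next : Bool → M.tm.Λ)
      (w : Word) (b : Bool) (h : M.query l = some next)
      (hw : (S M.queryStack).map M.queryAlphabet = w.1) (hb : b ∈ (φ w : Set Bool)) :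
      Step M φ ⟨some l, v, S⟩ ⟨some (next b), v, Function.update S M.queryStack []⟩

/-- The initial configuration on input `x`. -/
def init (M : OracleTM) (x : Word) : M.tm.Cfg :=
  Turing.initList M.tm (x.1.map M.inputAlphabet.symm)

/-- The halting configuration with output `b`. -/
def halted (M : OracleTM) (b : Bool) : M.tm.Cfg :=
  Turing.haltList M.tm [M.outputAlphabet.symm b]

/-- `M.AllPaths φ A t c`: every possible path of `M` with an oracle for `φ`, starting from the
configuration `c`, halts within `t` steps with an output that belongs to `A`. -/
inductive AllPaths (M : OracleTM) (φ : PromiseProblem) (A : Set Bool) : ℕ → M.tm.Cfg → Prop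
  | halt (t : ℕ) (c : M.tm.Cfg) (b : Bool) (hb : b ∈ A) (hc : c = M.halted b) :
      AllPaths M φ A t c
  | step (t : ℕ) (c : M.tm.Cfg) (hex : ∃ c', M.Step φ c c')
      (hall : ∀ c', M.Step φ c c' → AllPaths M φ A t c') : AllPaths M φ A (t + 1) c

end OracleTM

/-- `φ₁ ∝_T φ₂`: there are a `φ₂`-oracle Turing machine `M` and a polynomial `p` such that on every
input `x` every possible path of `M` runs in time at most `p(|x|)` and computes some element of
`φ₁ x`. -/
def WeakReduces (φ₁ φ₂ : PromiseProblem) : Prop :=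
  ∃ (M : OracleTM) (p : Polynomial ℕ), ∀ x : Word,
    M.AllPaths φ₂ (φ₁ x : Set Bool) (p.eval x.1.length) (M.init x)

/-- The weak closure `P̂^φ₂ = {φ₁ | φ₁ ∝_T φ₂}` of a promise problem. -/
def weakClosure (φ₂ : PromiseProblem) : Set PromiseProblem :=
  {φ₁ | WeakReduces φ₁ φ₂}

/-- `P̂^X` for a class `X` of promise problems: everything that is Turing reducible to a problem
in `X`. -/
def weakClosureOfClass (X : Set PromiseProblem) : Set PromiseProblem :=
  {φ₁ | ∃ φ₂ ∈ X, WeakReduces φ₁ φ₂}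

/-! ### Boolean expressions and their encoding -/

/-- Boolean expressions; `var i j` is the `j`-th variable of the `i`-th block (counting from 0). -/
inductive BoolExpr : Type
  | var (i j : ℕ) : BoolExpr
  | neg (f : BoolExpr) : BoolExpr
  | and (f g : BoolExpr) : BoolExpr
  | or (f g : BoolExpr) : BoolExpr

namespace BoolExpr

/-- All variables of the expression belong to blocks of the sizes `ms`. -/
def WellFormed (ms : List ℕ) : BoolExpr → Prop
  | var i j => j < ms.getD i 0
  | neg f => f.WellFormed ms
  | and f g => f.WellFormed ms ∧ g.WellFormed ms
  | or f g => f.WellFormed ms ∧ g.WellFormed ms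

/-- The value when the `i`-th entry of `ys` is the word assigned to the `i`-th block. -/
def eval (ys : List (List Bool)) : BoolExpr → Bool
  | var i j => (ys.getD i []).getD j false
  | neg f => !f.eval ys
  | and f g => f.eval ys && g.eval ys
  | or f g => f.eval ys || g.eval ys

end BoolExpr

/-- The unary encoding `1^k 0` of `k`. -/
def unary (k : ℕ) : List Bool := List.replicate k true ++ [false]

/-- The encoding of a Boolean expression as a word: prefix (Polish) notation with the tokens `00`
for `¬`, `01` for `∧`, `10` for `∨`, and `11` followed by the two indices for a variable. -/
def BoolExpr.encode : BoolExpr → List Bool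
  | var i j => true :: true :: (unary i ++ unary j)
  | neg f => false :: false :: f.encode
  | and f g => false :: true :: (f.encode ++ g.encode)
  | or f g => true :: false :: (f.encode ++ g.encode)

/-- A function `f : Σ^{m₁} × ⋯ × Σ^{mₙ} → Σ`, given by its block sizes `m₁, …, mₙ ≥ 1` and a Boolean
expression in the `m₁ + ⋯ + mₙ` variables. -/
structure Instance (n : ℕ) where
  /-- the block sizes `m₁, …, mₙ` -/
  sizes : List ℕ
  /-- the Boolean expression -/
  expr : BoolExpr
  length_sizes : sizes.length = n
  one_le_sizes : ∀ m ∈ sizes, 1 ≤ m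
  wellFormed : expr.WellFormed sizes

namespace Instance

/-- The encoding of a function as a word: the block sizes, then the Boolean expression. -/
def encode {n : ℕ} (I : Instance n) : List Bool :=
  I.sizes.flatMap unary ++ I.expr.encode

/-- The function itself, on the lists `[x, y⁽¹⁾, …, y⁽ⁿ⁻¹⁾]` of words of lengths `m₁, …, mₙ`. -/
def fn {n : ℕ} (I : Instance n) : List (List Bool) → Bool :=
  fun ys => I.expr.eval ys

end Instance

/-! ### The encoding is unambiguous -/

theorem unary_append_inj {k l : ℕ} {r s : List Bool} (h : unary k ++ r = unary l ++ s) :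
    k = l ∧ r = s := by
  induction k generalizing l with
  | zero => cases l <;> simp_all [unary, List.replicate_succ]
  | succ k ih =>
    cases l with
    | zero => simp [unary, List.replicate_succ] at h
    | succ l =>
      have h' : unary k ++ r = unary l ++ s := by
        simpa [unary, List.replicate_succ] using h
      have := ih h'
      exact ⟨by rw [this.1], this.2⟩

theorem BoolExpr.encode_append_inj (f g : BoolExpr) {r s : List Bool}
    (h : f.encode ++ r = g.encode ++ s) : f = g ∧ r = s := by
  induction f generalizing g r s with
  | var i j =>
    cases g <;> simp [BoolExpr.encode] at h
    have h₁ := unary_append_inj h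
    have h₂ := unary_append_inj h₁.2
    exact ⟨by rw [h₁.1, h₂.1], h₂.2⟩
  | neg f ih =>
    cases g <;> simp [BoolExpr.encode] at h
    have h₁ := ih _ h
    exact ⟨by rw [h₁.1], h₁.2⟩
  | and f₁ f₂ ih₁ ih₂ =>
    cases g <;> simp [BoolExpr.encode] at h
    have h₁ := ih₁ _ h
    have h₂ := ih₂ _ h₁.2
    exact ⟨by rw [h₁.1, h₂.1], h₂.2⟩
  | or f₁ f₂ ih₁ ih₂ =>
    cases g <;> simp [BoolExpr.encode] at h
    have h₁ := ih₁ _ h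
    have h₂ := ih₂ _ h₁.2
    exact ⟨by rw [h₁.1, h₂.1], h₂.2⟩

theorem flatMap_unary_append_inj {ms ls : List ℕ} (hlen : ms.length = ls.length)
    {r s : List Bool} (h : ms.flatMap unary ++ r = ls.flatMap unary ++ s) : ms = ls ∧ r = s := by
  induction ms generalizing ls with
  | nil => cases ls <;> simp_all
  | cons m ms ih =>
    cases ls with
    | nil => simp at hlen
    | cons l ls =>
      simp only [List.flatMap_cons, List.append_assoc] at h
      have h₁ := unary_append_inj h
      have h₂ := ih (by simpa using hlen) h₁.2
      exact ⟨by rw [h₁.1, h₂.1], h₂.2⟩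

/-- A word encodes at most one function. -/
theorem Instance.encode_injective {n : ℕ} :
    Function.Injective (Instance.encode : Instance n → List Bool) := by
  rintro ⟨ms, f, hm, _, _⟩ ⟨ls, g, hl, _, _⟩ h
  have h₁ := flatMap_unary_append_inj (hm.trans hl.symm) h
  have h₂ := BoolExpr.encode_append_inj f g (r := []) (s := []) (by simpa using h₁.2)
  obtain rfl := h₁.1
  obtain rfl := h₂.1
  rfl

/-! ### The problems `SATₙ` and `VALₙ` -/

mutual

/-- `Sat [m₁, …, mₙ] f`, that is, `SATₙ(f) = 1`, for `f` on `Σ^{m₁} × ⋯ × Σ^{mₙ}`: there is `x` with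
`coSATₙ₋₁(f_x) = 1`. -/
def Sat : List ℕ → (List (List Bool) → Bool) → Prop
  | [], f => f [] = true
  | m :: ms, f => ∃ x : List Bool, x.length = m ∧ CoSat ms (fun ys => f (x :: ys))

/-- `CoSat [m₁, …, mₙ] f`, that is, `coSATₙ(f) = 1`: all `x` have `SATₙ₋₁(f_x) = 1`. -/
def CoSat : List ℕ → (List (List Bool) → Bool) → Prop
  | [], f => f [] = true
  | m :: ms, f => ∀ x : List Bool, x.length = m → Sat ms (fun ys => f (x :: ys))

end

/-- The set `{x | coSATₙ₋₁(f_x) = 1}` of the words `x ∈ Σ^{m₁}` that witness `SATₙ(f) = 1`. -/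
def witnesses : List ℕ → (List (List Bool) → Bool) → Set (List Bool)
  | [], _ => ∅
  | m :: ms, f => {x | x.length = m ∧ CoSat ms (fun ys => f (x :: ys))}

/-- `{π₁ x | coSATₙ₋₁(f_x) = 1}`. -/
def firstBits (ms : List ℕ) (f : List (List Bool) → Bool) : Set Bool :=
  {b | ∃ x ∈ witnesses ms f, x.head? = some b}

theorem firstBits_nonempty {n : ℕ} (I : Instance n) (hn : n ≠ 0) (h : Sat I.sizes I.fn) :
    (firstBits I.sizes I.fn).Nonempty := by
  obtain ⟨ms, f, hl, h1, hw⟩ := I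
  cases ms with
  | nil => exact absurd hl.symm hn
  | cons m ms =>
    simp only [Sat] at h
    obtain ⟨x, hx, hc⟩ := h
    cases x with
    | nil =>
      have := h1 m (by simp)
      simp at hx
      omega
    | cons b x => exact ⟨b, b :: x, ⟨hx, hc⟩, rfl⟩

open Classical in
/-- The value `VALₙ(f)`: it is `{π₁ x | coSATₙ₋₁(f_x) = 1}` if `SATₙ(f) = 1`, and `Σ` otherwise.
(Without blocks there is no `x`; the convention there is `Σ`.) -/
noncomputable def Instance.val {n : ℕ} (I : Instance n) : PPlus :=
  if h : n ≠ 0 ∧ Sat I.sizes I.fn then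
    ⟨firstBits I.sizes I.fn, firstBits_nonempty I h.1 h.2⟩
  else ⟨Set.univ, Set.univ_nonempty⟩

open Classical in
/-- The non-promise problem `SATₙ`; a word that encodes no function has the answer `0`. -/
noncomputable def SAT (n : ℕ) : Problem :=
  fun w => decide (∃ I : Instance n, I.encode = w.1 ∧ Sat I.sizes I.fn)

open Classical in
/-- The promise problem `VALₙ`; for a word that encodes no function both answers are valid. -/
noncomputable def VAL (n : ℕ) : PromiseProblem :=
  fun w => if h : ∃ I : Instance n, I.encode = w.1 then h.choose.val
    else ⟨Set.univ, Set.univ_nonempty⟩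

/-- `VALₙ` on the encoding of a function is the value at that function. -/
theorem VAL_encode {n : ℕ} (I : Instance n) (w : Word) (h : I.encode = w.1) :
    VAL n w = I.val := by
  have hex : ∃ J : Instance n, J.encode = w.1 := ⟨I, h⟩
  have : hex.choose = I := Instance.encode_injective (hex.choose_spec.trans h.symm)
  rw [VAL, dif_pos hex, this]

/-! ### The classes -/

/-- `V̂ₙ = [VALₙ]`. -/
noncomputable def VHat (n : ℕ) : Set PromiseProblem := strongClosure (VAL n)

/-- `Δ̂ₖ = P̂^{SATₖ₋₁}` (for `k ≥ 2`), that is, `Δ̂ₙ₊₁ = P̂^{SATₙ}` for `n ≥ 1`. -/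
noncomputable def DeltaHat (k : ℕ) : Set PromiseProblem := weakClosure (SAT (k - 1)).toPromise

end PromiseHierarchy

open PromiseHierarchy

/-!
`VALₙ` needs one query to `SATₙ`: the letter `1` is a valid answer iff `x₁ ∧ f` is a yes-instance,
and if it is not valid although `f` has a solution, then `0` is.

Conversely, `SATₙ` is decided with `VALₙ` by playing the game block by block. The letters of a
solution of the current block are found one at a time: as the oracle only reports a first letter,
each letter found is substituted into the formula and the block is shortened, and dummy blocks of
size one keep the number of blocks equal to `n`. If there is a solution, this finds one. What
remains is a game of the same kind with the opponent to move and the function negated.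

Weak reductions compose because the machine that asks the queries can run the one that answers them,
and a strong reduction is a weak one that asks a single query. The two algorithms are written as
structured programs over named stacks of bits, which are translated into oracle machines; since an
oracle may answer the same query differently, a program is specified by what holds on all its runs.
-/

namespace PromiseHierarchy

open Turing

/-! ### Paths of oracle machines -/

instance fintypeStacks (tm : FinTM2) : Fintype tm.K := tm.kFin
instance fintypeLabels (tm : FinTM2) : Fintype tm.Λ := tm.ΛFin
instance fintypeStates (tm : FinTM2) : Fintype tm.σ := tm.σFin

theorem initList_eq (tm : FinTM2) (s : List (tm.Γ tm.k₀)) :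
    initList tm s =
      ⟨some tm.main, tm.initialState, Function.update (fun _ => []) tm.k₀ s⟩ := by
  unfold initList
  congr 1
  funext k
  obtain rfl | h := eq_or_ne k tm.k₀ <;> simp [*]

theorem haltList_eq (tm : FinTM2) (s : List (tm.Γ tm.k₁)) :
    haltList tm s =
      ⟨none, tm.initialState, Function.update (fun _ => []) tm.k₁ s⟩ := by
  unfold haltList
  congr 1
  funext k
  obtain rfl | h := eq_or_ne k tm.k₁ <;> simp [*]

namespace OracleTM

theorem init_eq (M : OracleTM) (x : Word) : M.init x = ⟨some M.tm.main, M.tm.initialState,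
    Function.update (fun _ => []) M.tm.k₀ (x.1.map M.inputAlphabet.symm)⟩ :=
  initList_eq _ _

theorem halted_eq (M : OracleTM) (b : Bool) : M.halted b = ⟨none, M.tm.initialState,
    Function.update (fun _ => []) M.tm.k₁ [M.outputAlphabet.symm b]⟩ :=
  haltList_eq _ _

/-- `Leads M φ P t c`: every path of `M` with an oracle for `φ` from the configuration `c` meets
`P` within `t` steps. This is `AllPaths` with an arbitrary target, so that it composes. -/
inductive Leads (M : OracleTM) (φ : PromiseProblem) (P : M.tm.Cfg → Prop) : ℕ → M.tm.Cfg → Prop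
  | done (t : ℕ) (c : M.tm.Cfg) (h : P c) : Leads M φ P t c
  | step (t : ℕ) (c : M.tm.Cfg) (hex : ∃ c', M.Step φ c c')
      (hall : ∀ c', M.Step φ c c' → Leads M φ P t c') : Leads M φ P (t + 1) c

variable {M : OracleTM} {φ : PromiseProblem} {P Q : M.tm.Cfg → Prop} {t u : ℕ} {c : M.tm.Cfg}

theorem Leads.mono (h : Leads M φ P t c) (htu : t ≤ u) : Leads M φ P u c := by
  induction h generalizing u with
  | done t c h => exact .done _ _ h
  | step t c hex _ ih =>
    obtain ⟨u, rfl⟩ : ∃ v, u = v + 1 := ⟨u - 1, by omega⟩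
    exact .step _ _ hex fun c' hc => ih c' hc (by omega)

theorem Leads.trans (h : Leads M φ P t c) (hPQ : ∀ c', P c' → Leads M φ Q u c') :
    Leads M φ Q (t + u) c := by
  induction h with
  | done t c h => exact (hPQ c h).mono (Nat.le_add_left u t)
  | step t c hex _ ih =>
    rw [Nat.add_right_comm]
    exact .step _ _ hex ih

theorem allPaths_iff_leads {A : Set Bool} :
    M.AllPaths φ A t c ↔ Leads M φ (fun c => ∃ b ∈ A, c = M.halted b) t c := by
  constructor
  · intro h
    induction h with
    | halt t c b hb hc => exact .done _ _ ⟨b, hb, hc⟩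
    | step t c hex _ ih => exact .step _ _ hex ih
  · intro h
    induction h with
    | done t c h => obtain ⟨b, hb, hc⟩ := h; exact .halt _ _ b hb hc
    | step t c hex _ ih => exact .step _ _ hex ih

section Steps

variable {l : M.tm.Λ} {v : M.tm.σ} {S : ∀ k, List (M.tm.Γ k)}

theorem leads_compute (hl : M.query l = none) (hc : TM2.stepAux (M.tm.m l) v S = c)
    (h : Leads M φ P t c) : Leads M φ P (t + 1) ⟨some l, v, S⟩ := by
  subst hc
  refine .step _ _ ⟨_, .compute l v S hl⟩ fun c' hc => ?_
  cases hc with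
  | compute => exact h
  | ask _ _ _ _ _ _ h' => simp [hl] at h'

theorem leads_ask {next : Bool → M.tm.Λ} (hl : M.query l = some next) {w : Word}
    (hw : (S M.queryStack).map M.queryAlphabet = w.1)
    (h : ∀ b ∈ (φ w : Set Bool),
      Leads M φ P t ⟨some (next b), v, Function.update S M.queryStack []⟩) :
    Leads M φ P (t + 1) ⟨some l, v, S⟩ := by
  obtain ⟨b, hb⟩ := (φ w).2
  refine .step _ _ ⟨_, .ask l v S next w b hl hw hb⟩ fun c' hc => ?_
  cases hc with
  | compute _ _ _ h' => simp [hl] at h'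
  | ask _ _ _ next' w' b' h' hw' hb' =>
    obtain rfl : next = next' := by simpa [hl] using h'
    obtain rfl : w = w' := Subtype.ext (hw.symm.trans hw')
    exact h b' hb'

end Steps

end OracleTM

/-! ### Embedding the statements of a machine into a larger machine -/

section Embedding

variable {K K₂ Λ Λ₂ σ σ₂ : Type} {Γ : K₂ → Type}

/-- The data that place a machine with stacks `K`, labels `Λ` and internal states `σ` inside a
larger machine. The smaller machine halts by jumping to the label `exit`, or, when that is `none`,
by halting the larger machine. -/
structure Embedding (K Λ σ K₂ Λ₂ σ₂ : Type) where
  /-- the place of a stack -/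
  stack : K → K₂
  /-- the place of a label -/
  label : Λ → Λ₂
  /-- the label at which the larger machine continues after the smaller one has halted -/
  exit : Option Λ₂
  /-- the internal state of the smaller machine, as a component of the larger one's -/
  get : σ₂ → σ
  /-- the replacement of that component -/
  put : σ₂ → σ → σ₂

namespace Embedding

variable (E : Embedding K Λ σ K₂ Λ₂ σ₂)

/-- A statement of the smaller machine as one of the larger machine. -/
def stmt : TM2.Stmt (fun k => Γ (E.stack k)) Λ σ → TM2.Stmt Γ Λ₂ σ₂
  | .push k f q => .push (E.stack k) (fun v => f (E.get v)) (stmt q)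
  | .peek k f q => .peek (E.stack k) (fun v o => E.put v (f (E.get v) o)) (stmt q)
  | .pop k f q => .pop (E.stack k) (fun v o => E.put v (f (E.get v) o)) (stmt q)
  | .load f q => .load (fun v => E.put v (f (E.get v))) (stmt q)
  | .branch f p q => .branch (fun v => f (E.get v)) (stmt p) (stmt q)
  | .goto f => .goto fun v => E.label (f (E.get v))
  | .halt => E.exit.elim .halt fun l => .goto fun _ => l

variable [DecidableEq K] [DecidableEq K₂]

/-- The parts of a configuration of the larger machine that the smaller one does not touch, given
by the ways to complete a state and the stacks of the smaller machine. -/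
structure Frame (Γ : K₂ → Type) where
  /-- the completion of an internal state -/
  fullState : σ → σ₂
  /-- the completion of the stacks -/
  fullStacks : (∀ k, List (Γ (E.stack k))) → ∀ k, List (Γ k)
  get_fullState : ∀ v, E.get (fullState v) = v
  put_fullState : ∀ v w, E.put (fullState v) w = fullState w
  update_fullStacks : ∀ S k s,
    Function.update (fullStacks S) (E.stack k) s =
      fullStacks (Function.update S k s)

namespace Frame

variable {E} (F : E.Frame Γ)

/-- The configuration of the larger machine completed by the frame. -/
def cfg (c : TM2.Cfg (fun k => Γ (E.stack k)) Λ σ) : TM2.Cfg Γ Λ₂ σ₂ :=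
  ⟨c.l.elim E.exit fun l => some (E.label l), F.fullState c.var, F.fullStacks c.stk⟩

theorem fullStacks_apply (S : ∀ k, List (Γ (E.stack k))) (k : K) :
    F.fullStacks S (E.stack k) = S k := by
  have h := F.update_fullStacks S k (S k)
  rw [Function.update_eq_self] at h
  rw [← h, Function.update_self]

theorem stepAux_stmt (q : TM2.Stmt (fun k => Γ (E.stack k)) Λ σ) (v : σ)
    (S : ∀ k, List (Γ (E.stack k))) :
    TM2.stepAux (E.stmt q) (F.fullState v) (F.fullStacks S) = F.cfg (TM2.stepAux q v S) := by
  induction q generalizing v S with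
  | branch f p q ihp ihq =>
    simp only [stmt, TM2.stepAux, F.get_fullState]
    cases f v
    · exact ihq _ _
    · exact ihp _ _
  | goto f => simp [stmt, TM2.stepAux, cfg, F.get_fullState]
  | halt => cases h : E.exit <;> simp [stmt, TM2.stepAux, cfg, h]
  | _ =>
    simp only [stmt, TM2.stepAux, F.get_fullState, F.put_fullState, F.fullStacks_apply,
      F.update_fullStacks, *]

end Frame

end Embedding

end Embedding

/-! ### Composition of oracle machines -/

namespace OracleTM

/-- The phases of serving a query: its word is moved to the auxiliary stack, from there to the
input stack of the inner machine (two moves, so that the order is kept), and after the run of that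
machine its output is taken as the answer. -/
inductive ServicePhase : Type
  | fetch
  | pass
  | answer
  deriving DecidableEq

instance : Fintype ServicePhase where
  elems := {.fetch, .pass, .answer}
  complete p := by cases p <;> decide

section Comp

variable (M N : OracleTM)

/-- The stacks of the composition: those of both machines and an auxiliary one. -/
abbrev CompStack : Type := M.tm.K ⊕ (N.tm.K ⊕ Unit)

/-- The alphabets of the stacks of the composition. -/
abbrev CompAlphabet : CompStack M N → Type
  | .inl k => M.tm.Γ k
  | .inr (.inl k) => N.tm.Γ k
  | .inr (.inr _) => Bool

/-- The labels of the composition; those of the form `inr (l, _)` serve the query at the label `l`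
of `M`. -/
abbrev CompLabel : Type := M.tm.Λ ⊕ (M.tm.Λ × (N.tm.Λ ⊕ ServicePhase))

/-- The internal states of the composition, with a register for the letter being moved. -/
abbrev CompState : Type := M.tm.σ × N.tm.σ × Option Bool

/-- The contents of all stacks of the composition. -/
def joinStacks {M N : OracleTM} (S : ∀ k, List (M.tm.Γ k)) (T : ∀ k, List (N.tm.Γ k))
    (a : List Bool) : ∀ k, List (CompAlphabet M N k)
  | .inl k => S k
  | .inr (.inl k) => T k
  | .inr (.inr _) => a

section JoinStacks

variable {M N} (S : ∀ k, List (M.tm.Γ k)) (T : ∀ k, List (N.tm.Γ k)) (a : List Bool)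

theorem update_joinStacks_outer (k : M.tm.K) (s : List (M.tm.Γ k)) :
    Function.update (joinStacks S T a) (.inl k) s = joinStacks (Function.update S k s) T a := by
  funext j
  rcases j with j | j | j
  · obtain rfl | h := eq_or_ne j k
    · exact (Function.update_self ..).trans (Function.update_self (f := S) ..).symm
    · exact (Function.update_of_ne (by simpa using h) ..).trans (Function.update_of_ne h ..).symm
  · exact Function.update_of_ne (by simp) ..
  · exact Function.update_of_ne (by simp) ..

theorem update_joinStacks_inner (k : N.tm.K) (s : List (N.tm.Γ k)) :
    Function.update (joinStacks S T a) (.inr (.inl k)) s =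
      joinStacks S (Function.update T k s) a := by
  funext j
  rcases j with j | j | j
  · exact Function.update_of_ne (by simp) ..
  · obtain rfl | h := eq_or_ne j k
    · exact (Function.update_self ..).trans (Function.update_self (f := T) ..).symm
    · exact (Function.update_of_ne (by simpa using h) ..).trans (Function.update_of_ne h ..).symm
  · exact Function.update_of_ne (by simp) ..

theorem update_joinStacks_aux (s : List Bool) :
    Function.update (joinStacks S T a) (.inr (.inr ())) s = joinStacks S T s := by
  funext j
  rcases j with j | j | _
  · exact Function.update_of_ne (by simp) ..
  · exact Function.update_of_ne (by simp) ..
  · exact Function.update_self ..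

theorem joinStacks_nil :
    (joinStacks (fun _ => []) (fun _ => []) [] : ∀ k, List (CompAlphabet M N k)) =
      fun _ => [] := by
  funext k
  rcases k with k | k | k <;> rfl

end JoinStacks

/-- The place of the outer machine in the composition. -/
def outer : Embedding M.tm.K M.tm.Λ M.tm.σ (CompStack M N) (CompLabel M N) (CompState M N) where
  stack := .inl
  label := .inl
  exit := none
  get v := v.1
  put v w := (w, v.2)

/-- The place of the inner machine in the composition while it serves the query at `l`. -/
def inner (l : M.tm.Λ) :
    Embedding N.tm.K N.tm.Λ N.tm.σ (CompStack M N) (CompLabel M N) (CompState M N) where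
  stack k := .inr (.inl k)
  label l' := .inr (l, .inl l')
  exit := some (.inr (l, .inr .answer))
  get v := v.2.1
  put v w := (v.1, w, v.2.2)

/-- The composition while the inner machine is idle. -/
def outerFrame : (outer M N).Frame (CompAlphabet M N) where
  fullState v := (v, N.tm.initialState, none)
  fullStacks S := joinStacks S (fun _ => []) []
  get_fullState _ := rfl
  put_fullState _ _ := rfl
  update_fullStacks S k s := update_joinStacks_outer S _ _ k s

/-- The composition while the outer machine waits at the label `l`. -/
def innerFrame (l : M.tm.Λ) (v : M.tm.σ) (S : ∀ k, List (M.tm.Γ k)) :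
    (inner M N l).Frame (CompAlphabet M N) where
  fullState w := (v, w, none)
  fullStacks T := joinStacks S T []
  get_fullState _ := rfl
  put_fullState _ _ := rfl
  update_fullStacks T k s := update_joinStacks_inner S T _ k s

/-- The statement of the composition at a label. -/
def compStmt : CompLabel M N → TM2.Stmt (CompAlphabet M N) (CompLabel M N) (CompState M N)
  | .inl l =>
    if (M.query l).isSome then .goto fun _ => .inr (l, .inr .fetch)
    else (outer M N).stmt (M.tm.m l)
  | .inr (l, .inl l') => (inner M N l).stmt (N.tm.m l')
  | .inr (l, .inr .fetch) =>
    .pop (.inl M.queryStack) (fun v o => (v.1, v.2.1, o.map M.queryAlphabet)) <|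
      .branch (fun v => v.2.2.isSome)
        (.push (.inr (.inr ())) (fun v => v.2.2.getD false) <|
          .goto fun _ => .inr (l, .inr .fetch))
        (.goto fun _ => .inr (l, .inr .pass))
  | .inr (l, .inr .pass) =>
    .pop (.inr (.inr ())) (fun v o => (v.1, v.2.1, o)) <|
      .branch (fun v => v.2.2.isSome)
        (.push (.inr (.inl N.tm.k₀)) (fun v => N.inputAlphabet.symm (v.2.2.getD false)) <|
          .goto fun _ => .inr (l, .inr .pass))
        (.goto fun _ => .inr (l, .inl N.tm.main))
  | .inr (l, .inr .answer) =>
    .pop (.inr (.inl N.tm.k₁)) (fun v o => (v.1, v.2.1, o.map N.outputAlphabet)) <|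
      .branch (fun v => v.2.2.getD false)
        (.load (fun v => (v.1, v.2.1, none)) <|
          .goto fun _ => .inl (((M.query l).getD fun _ => l) true))
        (.load (fun v => (v.1, v.2.1, none)) <|
          .goto fun _ => .inl (((M.query l).getD fun _ => l) false))

/-- The machine `M` with its oracle answers computed by the oracle machine `N`. -/
def comp : OracleTM where
  tm :=
    { K := CompStack M N
      k₀ := .inl M.tm.k₀
      k₁ := .inl M.tm.k₁
      Γ := CompAlphabet M N
      Λ := CompLabel M N
      main := .inl M.tm.main
      σ := CompState M N
      initialState := (M.tm.initialState, N.tm.initialState, none)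
      Γk₀Fin := M.tm.Γk₀Fin
      m := compStmt M N }
  inputAlphabet := M.inputAlphabet
  outputAlphabet := M.outputAlphabet
  queryStack := .inr (.inl N.queryStack)
  queryAlphabet := N.queryAlphabet
  query
    | .inr (l, .inl l') => (N.query l').map fun next b => .inr (l, .inl (next b))
    | _ => none

variable {M N}

theorem outerFrame_init (x : Word) : (outerFrame M N).cfg (M.init x) = (M.comp N).init x := by
  rw [init_eq, init_eq]
  unfold Embedding.Frame.cfg outerFrame
  dsimp only [Option.elim_some]
  rw [← update_joinStacks_outer, joinStacks_nil]
  rfl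

theorem outerFrame_halted (b : Bool) :
    (outerFrame M N).cfg (M.halted b) = (M.comp N).halted b := by
  rw [halted_eq, halted_eq]
  unfold Embedding.Frame.cfg outerFrame
  dsimp only [Option.elim_none]
  rw [← update_joinStacks_outer, joinStacks_nil]
  rfl

variable {φ ψ : PromiseProblem} {t u : ℕ}

theorem leads_comp_compute {P : (M.comp N).tm.Cfg → Prop} {l : M.tm.Λ} (hl : M.query l = none)
    {v : M.tm.σ} {S : ∀ k, List (M.tm.Γ k)}
    (h : Leads (M.comp N) φ P t ((outerFrame M N).cfg (TM2.stepAux (M.tm.m l) v S))) :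
    Leads (M.comp N) φ P (t + 1) ((outerFrame M N).cfg ⟨some l, v, S⟩) := by
  have hstmt : compStmt M N (.inl l) = (outer M N).stmt (M.tm.m l) := by simp [compStmt, hl]
  refine leads_compute (M := M.comp N) rfl ?_ h
  exact (congrArg (fun q => TM2.stepAux q _ _) hstmt).trans
    ((outerFrame M N).stepAux_stmt (M.tm.m l) v S)

theorem leads_comp_inner {P : N.tm.Cfg → Prop} (l : M.tm.Λ) (v : M.tm.σ)
    (S : ∀ k, List (M.tm.Γ k)) {c : N.tm.Cfg} (h : Leads N φ P t c) :
    Leads (M.comp N) φ (fun c => ∃ c', P c' ∧ c = (innerFrame M N l v S).cfg c') t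
      ((innerFrame M N l v S).cfg c) := by
  induction h with
  | done t c h => exact .done _ _ ⟨c, h, rfl⟩
  | step t c hex _ ih =>
    obtain ⟨c', hs⟩ := hex
    cases hs with
    | compute l' u T hq =>
      exact leads_compute (M := M.comp N) (by simp [comp, inner, hq])
        ((innerFrame M N l v S).stepAux_stmt (N.tm.m l') u T) (ih _ (.compute l' u T hq))
    | ask l' u T next w b hq hw hb =>
      refine leads_ask (M := M.comp N) (w := w) (next := fun b => .inr (l, .inl (next b)))
        (by simp [comp, inner, hq]) hw fun b' hb' => ?_
      refine (congrArg (Leads (M.comp N) φ _ t) ?_).mp (ih _ (.ask l' u T next w b' hq hw hb'))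
      exact congrArg (TM2.Cfg.mk _ _) ((innerFrame M N l v S).update_fullStacks T _ _).symm

end Comp
end OracleTM

namespace OracleTM

section Query

variable {M N : OracleTM}

theorem stepAux_fetch_nil (l : M.tm.Λ) (v : M.tm.σ) (r : Option Bool)
    {S : ∀ k, List (M.tm.Γ k)} (T : ∀ k, List (N.tm.Γ k)) (a : List Bool)
    (hS : S M.queryStack = []) :
    TM2.stepAux (compStmt M N (.inr (l, .inr .fetch))) (v, N.tm.initialState, r)
      (joinStacks S T a) = ⟨some (.inr (l, .inr .pass)), (v, N.tm.initialState, none),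
        joinStacks (Function.update S M.queryStack []) T a⟩ := by
  have htop : joinStacks S T a (.inl M.queryStack) = [] := hS
  simp only [compStmt, TM2.stepAux, htop, update_joinStacks_outer]
  rfl

theorem stepAux_fetch_cons (l : M.tm.Λ) (v : M.tm.σ) (r : Option Bool)
    {S : ∀ k, List (M.tm.Γ k)} (T : ∀ k, List (N.tm.Γ k)) (a : List Bool)
    {x : M.tm.Γ M.queryStack} {s : List (M.tm.Γ M.queryStack)} (hS : S M.queryStack = x :: s) :
    TM2.stepAux (compStmt M N (.inr (l, .inr .fetch))) (v, N.tm.initialState, r)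
      (joinStacks S T a) = ⟨some (.inr (l, .inr .fetch)),
        (v, N.tm.initialState, some (M.queryAlphabet x)),
        joinStacks (Function.update S M.queryStack s) T (M.queryAlphabet x :: a)⟩ := by
  have htop : joinStacks S T a (.inl M.queryStack) = x :: s := hS
  simp only [compStmt, TM2.stepAux, htop, update_joinStacks_outer, update_joinStacks_aux]
  rfl

theorem stepAux_pass_nil (l : M.tm.Λ) (v : M.tm.σ) (r : Option Bool)
    (S : ∀ k, List (M.tm.Γ k)) (T : ∀ k, List (N.tm.Γ k)) :
    TM2.stepAux (compStmt M N (.inr (l, .inr .pass))) (v, N.tm.initialState, r)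
      (joinStacks S T []) = ⟨some (.inr (l, .inl N.tm.main)), (v, N.tm.initialState, none),
        joinStacks S T []⟩ := by
  have htop : joinStacks S T [] (.inr (.inr ())) = [] := rfl
  simp only [compStmt, TM2.stepAux, htop, update_joinStacks_aux]
  rfl

theorem stepAux_pass_cons (l : M.tm.Λ) (v : M.tm.σ) (r : Option Bool)
    (S : ∀ k, List (M.tm.Γ k)) (T : ∀ k, List (N.tm.Γ k)) (x : Bool) (a : List Bool) :
    TM2.stepAux (compStmt M N (.inr (l, .inr .pass))) (v, N.tm.initialState, r)
      (joinStacks S T (x :: a)) =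
      ⟨some (.inr (l, .inr .pass)), (v, N.tm.initialState, some x), joinStacks S
        (Function.update T N.tm.k₀ (N.inputAlphabet.symm x :: T N.tm.k₀)) a⟩ := by
  have haux : joinStacks S T (x :: a) (.inr (.inr ())) = x :: a := rfl
  have hin : joinStacks S T a (.inr (.inl N.tm.k₀)) = T N.tm.k₀ := rfl
  simp only [compStmt, TM2.stepAux, haux, update_joinStacks_aux, update_joinStacks_inner,
    List.tail_cons, hin]
  rfl

theorem stepAux_answer {l : M.tm.Λ} {next : Bool → M.tm.Λ} (hl : M.query l = some next)
    (v : M.tm.σ) (S : ∀ k, List (M.tm.Γ k)) (b : Bool) :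
    TM2.stepAux (compStmt M N (.inr (l, .inr .answer))) (v, N.tm.initialState, none)
      (joinStacks S (Function.update (fun _ => []) N.tm.k₁ [N.outputAlphabet.symm b]) []) =
      (outerFrame M N).cfg ⟨some (next b), v, S⟩ := by
  have htop : joinStacks S (Function.update (fun _ => []) N.tm.k₁ [N.outputAlphabet.symm b]) []
      (.inr (.inl N.tm.k₁)) = [N.outputAlphabet.symm b] :=
    Function.update_self (f := fun k => ([] : List (N.tm.Γ k))) ..
  have hclear : Function.update (fun k => ([] : List (N.tm.Γ k))) N.tm.k₁ [] = fun _ => [] :=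
    Function.update_eq_self ..
  simp only [compStmt, TM2.stepAux, htop, update_joinStacks_inner, List.tail_cons,
    Function.update_idem, hclear, hl, List.head?_cons, Option.map_some, Equiv.apply_symm_apply,
    Option.getD_some]
  cases b <;> rfl

variable {φ ψ : PromiseProblem} {P : (M.comp N).tm.Cfg → Prop} {t u : ℕ}

theorem leads_comp_fetch (l : M.tm.Λ) (v : M.tm.σ) (r : Option Bool) {S : ∀ k, List (M.tm.Γ k)}
    {s : List (M.tm.Γ M.queryStack)} (hS : S M.queryStack = s) (a : List Bool)
    (h : Leads (M.comp N) ψ P t ⟨some (.inr (l, .inr .pass)), (v, N.tm.initialState, none),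
      joinStacks (Function.update S M.queryStack []) (fun _ => [])
        ((s.map M.queryAlphabet).reverse ++ a)⟩) :
    Leads (M.comp N) ψ P (t + s.length + 1) ⟨some (.inr (l, .inr .fetch)),
      (v, N.tm.initialState, r), joinStacks S (fun _ => []) a⟩ := by
  induction s generalizing S r a with
  | nil => exact leads_compute (M := M.comp N) rfl (stepAux_fetch_nil l v r _ a hS) h
  | cons x s ih =>
    refine leads_compute (M := M.comp N) rfl (stepAux_fetch_cons l v r _ a hS) ?_
    exact ih _ (S := Function.update S M.queryStack s) (by simp) _ (by simpa using h)

theorem leads_comp_pass (l : M.tm.Λ) (v : M.tm.σ) (r : Option Bool) (S : ∀ k, List (M.tm.Γ k))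
    (a : List Bool) (s : List (N.tm.Γ N.tm.k₀))
    (h : Leads (M.comp N) ψ P t ⟨some (.inr (l, .inl N.tm.main)), (v, N.tm.initialState, none),
      joinStacks S (Function.update (fun _ => []) N.tm.k₀
        ((a.map N.inputAlphabet.symm).reverse ++ s)) []⟩) :
    Leads (M.comp N) ψ P (t + a.length + 1) ⟨some (.inr (l, .inr .pass)),
      (v, N.tm.initialState, r),
      joinStacks S (Function.update (fun _ => []) N.tm.k₀ s) a⟩ := by
  induction a generalizing s r with
  | nil => exact leads_compute (M := M.comp N) rfl (stepAux_pass_nil l v r S _) h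
  | cons x a ih =>
    have hstep := stepAux_pass_cons l v r S (Function.update (fun _ => []) N.tm.k₀ s) x a
    rw [Function.update_idem,
      Function.update_self (f := fun k => ([] : List (N.tm.Γ k)))] at hstep
    exact leads_compute (M := M.comp N) rfl hstep
      (ih (some x) (N.inputAlphabet.symm x :: s) (by simpa using h))

theorem leads_comp_run {l : M.tm.Λ} {next : Bool → M.tm.Λ} (hl : M.query l = some next)
    {w : Word} {A : Set Bool} (hN : N.AllPaths ψ A u (N.init w)) (v : M.tm.σ)
    (S : ∀ k, List (M.tm.Γ k))
    (h : ∀ b ∈ A, Leads (M.comp N) ψ P t ((outerFrame M N).cfg ⟨some (next b), v, S⟩)) :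
    Leads (M.comp N) ψ P (u + (t + 1)) ⟨some (.inr (l, .inl N.tm.main)),
      (v, N.tm.initialState, none), joinStacks S
        (Function.update (fun _ => []) N.tm.k₀ (w.1.map N.inputAlphabet.symm)) []⟩ := by
  have hinner := leads_comp_inner l v S (allPaths_iff_leads.1 hN)
  rw [init_eq] at hinner
  refine Leads.trans hinner ?_
  rintro _ ⟨_, ⟨b, hb, rfl⟩, rfl⟩
  rw [halted_eq]
  exact leads_compute (M := M.comp N) rfl (stepAux_answer hl v S b) (h b hb)

theorem leads_comp_query {l : M.tm.Λ} {next : Bool → M.tm.Λ} (hl : M.query l = some next)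
    {w : Word} {A : Set Bool} (hN : N.AllPaths ψ A u (N.init w)) (v : M.tm.σ)
    {S : ∀ k, List (M.tm.Γ k)} (hw : (S M.queryStack).map M.queryAlphabet = w.1)
    (h : ∀ b ∈ A, Leads (M.comp N) ψ P t
      ((outerFrame M N).cfg ⟨some (next b), v, Function.update S M.queryStack []⟩)) :
    Leads (M.comp N) ψ P (t + u + 2 * w.1.length + 4)
      ((outerFrame M N).cfg ⟨some l, v, S⟩) := by
  have hlen : (S M.queryStack).length = w.1.length := by simp [← hw]
  have hgoto : compStmt M N (.inl l) = .goto fun _ => .inr (l, .inr .fetch) := by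
    simp [compStmt, hl]
  have hpass := leads_comp_pass (N := N) (ψ := ψ) (P := P) l v none
    (Function.update S M.queryStack []) w.1.reverse [] (by
      rw [List.map_reverse, List.reverse_reverse, List.append_nil]
      exact leads_comp_run hl hN v _ h)
  have hfetch := leads_comp_fetch (N := N) (ψ := ψ) (P := P) l v none (S := S) rfl []
    (by simpa [hw] using hpass)
  refine Leads.mono (leads_compute (M := M.comp N) rfl
    (congrArg (fun q => TM2.stepAux q _ _) hgoto) hfetch) ?_
  rw [hlen]
  omega

end Query

/-! ### Growth of the stacks -/

section Growth

variable {K Λ σ : Type} {Γ : K → Type}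

/-- A bound on the number of symbols that a statement pushes on any stack. -/
def stmtPushes : TM2.Stmt Γ Λ σ → ℕ
  | .push _ _ q => stmtPushes q + 1
  | .peek _ _ q | .pop _ _ q | .load _ q => stmtPushes q
  | .branch _ p q => stmtPushes p + stmtPushes q
  | .goto _ | .halt => 0

variable [DecidableEq K]

theorem length_stk_stepAux_le (q : TM2.Stmt Γ Λ σ) (v : σ) (S : ∀ k, List (Γ k)) (k : K) :
    ((TM2.stepAux q v S).stk k).length ≤ (S k).length + stmtPushes q := by
  induction q generalizing v S with
  | push j f q ih =>
    obtain rfl | h := eq_or_ne k j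
    · refine (ih _ _).trans_eq ?_
      rw [Function.update_self, List.length_cons, stmtPushes]
      omega
    · exact (ih _ _).trans (by simp [stmtPushes, h])
  | pop j f q ih =>
    refine (ih _ _).trans ?_
    obtain rfl | h := eq_or_ne k j <;> simp [stmtPushes, *]
  | branch f p q ihp ihq =>
    simp only [TM2.stepAux, stmtPushes]
    cases f v
    · exact (ihq _ _).trans (by omega)
    · exact (ihp _ _).trans (by omega)
  | peek j f _ ih => exact ih _ _
  | load f _ ih => exact ih _ _
  | goto f => simp [stmtPushes]
  | halt => simp [stmtPushes]

end Growth

/-- A bound on the number of symbols pushed in one step. -/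
def maxPushes (M : OracleTM) : ℕ := ∑ l, stmtPushes (M.tm.m l)

theorem length_stk_step_le {M : OracleTM} {φ : PromiseProblem} {c c' : M.tm.Cfg}
    (h : M.Step φ c c') (k : M.tm.K) :
    (c'.stk k).length ≤ (c.stk k).length + M.maxPushes := by
  cases h with
  | compute l v S _ =>
    refine (length_stk_stepAux_le _ v S k).trans (Nat.add_le_add_left ?_ _)
    exact Finset.single_le_sum (f := fun l => stmtPushes (M.tm.m l))
      (fun _ _ => Nat.zero_le _) (Finset.mem_univ l)
  | ask l v S _ _ _ _ _ _ =>
    obtain rfl | h := eq_or_ne k M.queryStack <;> simp [*]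

theorem length_stk_init_le (M : OracleTM) (x : Word) (k : M.tm.K) :
    ((M.init x).stk k).length ≤ x.1.length := by
  rw [init_eq]
  obtain rfl | h := eq_or_ne k M.tm.k₀ <;> simp [*]

end OracleTM

/-! ### Transitivity of weak reduction -/

theorem monotone_eval_nat (p : Polynomial ℕ) : Monotone fun n => p.eval n := by
  intro a b h
  simp only [Polynomial.eval_eq_sum_range]
  gcongr

namespace OracleTM

variable {M N : OracleTM} {φ ψ : PromiseProblem}

-- The bound `B` on the length of every query is fixed along the whole computation of `M`.
theorem AllPaths.comp {p : Polynomial ℕ}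
    (hN : ∀ w : Word, N.AllPaths ψ (φ w : Set Bool) (p.eval w.1.length) (N.init w))
    {A : Set Bool} {t : ℕ} {c : M.tm.Cfg} (h : M.AllPaths φ A t c) {B : ℕ}
    (hB : ∀ k, (c.stk k).length + M.maxPushes * t ≤ B) :
    Leads (M.comp N) ψ (fun c => ∃ b ∈ A, c = (M.comp N).halted b)
      (t * (p.eval B + 2 * B + 4)) ((outerFrame M N).cfg c) := by
  induction h with
  | halt t c b hb hc => exact .done _ _ ⟨b, hb, hc ▸ outerFrame_halted b⟩
  | step t c hex _ ih =>
    obtain ⟨c', hs⟩ := hex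
    have hbound {c' : M.tm.Cfg} (hc : M.Step φ c c') (k : M.tm.K) :
        (c'.stk k).length + M.maxPushes * t ≤ B := by
      have := length_stk_step_le hc k
      have := hB k
      rw [Nat.mul_succ] at this
      omega
    rw [Nat.succ_mul]
    cases hs with
    | compute l v S hl =>
      have hstep := Step.compute (φ := φ) l v S hl
      exact (leads_comp_compute hl (ih _ hstep (hbound hstep))).mono (by omega)
    | ask l v S next w b hl hw hb =>
      have hlen : w.1.length ≤ B := by
        have := hB M.queryStack
        have := congrArg List.length hw
        simp only [List.length_map] at this
        dsimp only at *
        omega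
      have hp := monotone_eval_nat p hlen
      refine (leads_comp_query (t := t * (p.eval B + 2 * B + 4)) hl (hN w) v hw
        fun b' hb' => ?_).mono (by dsimp only at hp; omega)
      have hstep := Step.ask l v S next w b' hl hw hb'
      exact ih _ hstep (hbound hstep)

end OracleTM

theorem WeakReduces.trans {φ₁ φ₂ φ₃ : PromiseProblem} (h₁ : WeakReduces φ₁ φ₂)
    (h₂ : WeakReduces φ₂ φ₃) : WeakReduces φ₁ φ₃ := by
  obtain ⟨M, p, hM⟩ := h₁
  obtain ⟨N, q, hN⟩ := h₂
  let B : Polynomial ℕ := .X + .C M.maxPushes * p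
  refine ⟨M.comp N, p * (q.comp B + 2 * B + 4), fun x => ?_⟩
  rw [OracleTM.allPaths_iff_leads, ← OracleTM.outerFrame_init]
  have h := (hM x).comp hN (B := B.eval x.1.length) fun k => by
    simpa [B] using M.length_stk_init_le x k
  simpa [Polynomial.eval_comp] using h

/-! ### Strong reductions are weak reductions -/

namespace OracleTM

section Karp

variable (T : TM2ComputableAux Bool Bool)

/-- The place of `T` in the machine `karp T`, where a query takes the place of halting. -/
def karpEmbedding :
    Embedding T.tm.K T.tm.Λ T.tm.σ T.tm.K (T.tm.Λ ⊕ Option Bool) T.tm.σ where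
  stack := id
  label := .inl
  exit := some (.inr none)
  get := id
  put _ := id

/-- The oracle machine that computes one query by `T` and outputs the answer. -/
def karp : OracleTM where
  tm :=
    { K := T.tm.K
      k₀ := T.tm.k₀
      k₁ := T.tm.k₁
      Γ := T.tm.Γ
      Λ := T.tm.Λ ⊕ Option Bool
      main := .inl T.tm.main
      σ := T.tm.σ
      initialState := T.tm.initialState
      Γk₀Fin := T.tm.Γk₀Fin
      m := fun
        | .inl l => (karpEmbedding T).stmt (T.tm.m l)
        | .inr none => .halt
        | .inr (some b) => .push T.tm.k₁ (fun _ => T.outputAlphabet.symm b) .halt }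
  inputAlphabet := T.inputAlphabet
  outputAlphabet := T.outputAlphabet
  queryStack := T.tm.k₁
  queryAlphabet := T.outputAlphabet
  query
    | .inr none => some fun b => .inr (some b)
    | _ => none

/-- The trivial frame: `karp T` has the stacks and the states of `T`. -/
def karpFrame : (karpEmbedding T).Frame T.tm.Γ where
  fullState := id
  fullStacks S := S
  get_fullState _ := rfl
  put_fullState _ _ := rfl
  update_fullStacks _ _ _ := rfl

theorem iterate_bind_none {α : Type*} (f : α → Option α) (n : ℕ) :
    (flip bind f)^[n] none = none :=
  Function.iterate_fixed rfl n

theorem leads_karp {φ : PromiseProblem} {n : ℕ} {c c' : T.tm.Cfg}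
    (h : (flip bind T.tm.step)^[n] (some c) = some c') :
    Leads (karp T) φ (fun d => d = (karpFrame T).cfg c') n ((karpFrame T).cfg c) := by
  induction n generalizing c with
  | zero =>
    obtain rfl : c = c' := by simpa using h
    exact .done _ _ rfl
  | succ n ih =>
    rw [Function.iterate_succ_apply] at h
    obtain ⟨l | l, v, S⟩ := c
    · exact absurd ((iterate_bind_none _ n).symm.trans h) (by simp)
    · exact leads_compute (M := karp T) rfl ((karpFrame T).stepAux_stmt (T.tm.m l) v S) (ih h)

theorem leads_karp_ask {φ : PromiseProblem} (w : Word) :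
    Leads (karp T) φ (fun c => ∃ b ∈ (φ w : Set Bool), c = (karp T).halted b) 2
      ((karpFrame T).cfg (haltList T.tm (w.1.map T.outputAlphabet.symm))) := by
  rw [haltList_eq]
  have hclear (s : List (T.tm.Γ T.tm.k₁)) :
      Function.update (Function.update (fun k => ([] : List (T.tm.Γ k))) T.tm.k₁ s) T.tm.k₁ [] =
        fun _ => [] := by
    rw [Function.update_idem]
    exact Function.update_eq_self ..
  refine leads_ask (M := karp T) (w := w) rfl ?_ fun b hb => ?_
  · refine (congrArg (List.map T.outputAlphabet) (Function.update_self
      (f := fun k => ([] : List (T.tm.Γ k))) ..)).trans ?_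
    rw [List.map_map, Equiv.self_comp_symm, List.map_id]
  · refine leads_compute (M := karp T) rfl rfl (.done _ _ ⟨b, hb, ?_⟩)
    rw [halted_eq]
    exact congrArg (TM2.stepAux (.push T.tm.k₁ (fun _ => T.outputAlphabet.symm b) .halt)
      T.tm.initialState) (hclear _)

end Karp

end OracleTM

theorem StrongReduces.weakReduces {φ₁ φ₂ : PromiseProblem} (h : StrongReduces φ₁ φ₂) :
    WeakReduces φ₁ φ₂ := by
  obtain ⟨μ, ⟨C⟩, hμ⟩ := h
  refine ⟨OracleTM.karp C.toTM2ComputableAux, C.time + 2, fun x => ?_⟩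
  have hrun := C.outputsFun x
  rw [OracleTM.allPaths_iff_leads, Polynomial.eval_add, Polynomial.eval_ofNat]
  refine ((OracleTM.leads_karp C.toTM2ComputableAux hrun.evals_in_steps).mono
    hrun.steps_le_m).trans ?_
  rintro _ rfl
  refine (OracleTM.leads_karp_ask C.toTM2ComputableAux (μ x)).trans (u := 0) ?_
  rintro _ ⟨b, hb, rfl⟩
  exact .done _ _ ⟨b, hμ x hb, rfl⟩

/-! ### Structured programs over stacks of bits -/

/-- Data that consist of stacks of bits indexed by `K`: the interface through which programs act
on records as well as on functions. -/
class StackStore (K : outParam Type) [DecidableEq K] (σ : Type*) where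
  /-- the contents of a stack -/
  stack : σ → K → List Bool
  /-- replacement of the contents of a stack -/
  setStack : σ → K → List Bool → σ
  stack_injective : Function.Injective stack
  stack_setStack (s : σ) (k : K) (l : List Bool) :
    stack (setStack s k l) = Function.update (stack s) k l

namespace StackStore

variable {K : Type} [DecidableEq K] {σ : Type*} [StackStore K σ] (s : σ) {k j : K}
  (l l' : List Bool)

theorem stack_setStack_self (k : K) : stack (setStack s k l) k = l := by
  rw [stack_setStack, Function.update_self]

theorem stack_setStack_of_ne (h : j ≠ k) : stack (setStack s k l) j = stack s j := by
  rw [stack_setStack, Function.update_of_ne h]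

theorem setStack_setStack (k : K) : setStack (setStack s k l) k l' = setStack s k l' := by
  apply stack_injective
  simp only [stack_setStack, Function.update_idem]

theorem setStack_stack (k : K) : setStack s k (stack s k) = s := by
  apply stack_injective
  rw [stack_setStack, Function.update_eq_self]

theorem setStack_comm (h : j ≠ k) :
    setStack (setStack s k l) j l' = setStack (setStack s j l') k l := by
  apply stack_injective
  simp only [stack_setStack]
  exact Function.update_comm h.symm _ _ _

theorem length_stack_setStack_le {s : σ} {n : ℕ} (hs : ∀ j, (stack s j).length ≤ n)
    (l : List Bool) (hl : l.length ≤ n) (k j : K) :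
    (stack (setStack s k l) j).length ≤ n := by
  obtain rfl | h := eq_or_ne j k
  · rwa [stack_setStack_self]
  · rw [stack_setStack_of_ne _ _ h]
    exact hs j

end StackStore

open StackStore

/-- Structured programs over stacks of bits indexed by `K`, with an oracle. -/
inductive Prog (K : Type) : Type
  | skip : Prog K
  | push (k : K) (b : Bool) (p : Prog K) : Prog K
  | pop (k : K) (p : Option Bool → Prog K) : Prog K
  | seq (p p' : Prog K) : Prog K
  | loop (k : K) (p : Bool → Prog K) : Prog K
  | ask (p : Bool → Prog K) : Prog K

/-- `Runs q φ p s t Q`: every run of `p` on the stacks of `s`, with queries from the stack `q` to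
`φ`, ends within `t` steps with stacks that satisfy `Q`. -/
inductive Runs {K : Type} [DecidableEq K] {σ : Type*} [StackStore K σ] (q : K)
    (φ : PromiseProblem) : Prog K → σ → ℕ → (σ → Prop) → Prop
  | skip {s t Q} (h : Q s) : Runs q φ .skip s (t + 1) Q
  | push {k b p s t Q} (h : Runs q φ p (setStack s k (b :: stack s k)) t Q) :
      Runs q φ (.push k b p) s (t + 1) Q
  | pop {k p s t Q} (h : Runs q φ (p (stack s k).head?) (setStack s k (stack s k).tail) t Q) :
      Runs q φ (.pop k p) s (t + 1) Q
  | seq {p p' s t u Q R} (h : Runs q φ p s t R) (h' : ∀ s', R s' → Runs q φ p' s' u Q) :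
      Runs q φ (.seq p p') s (t + u) Q
  | loop_nil {k p s t Q} (hs : stack s k = []) (h : Q s) : Runs q φ (.loop k p) s (t + 1) Q
  | loop_cons {k p s t u Q b l R} (hs : stack s k = b :: l)
      (h : Runs q φ (p b) (setStack s k l) t R)
      (h' : ∀ s', R s' → Runs q φ (.loop k p) s' u Q) : Runs q φ (.loop k p) s (t + u + 1) Q
  | ask {p s t Q} (w : Word) (hw : stack s q = w.1)
      (h : ∀ b ∈ (φ w : Set Bool), Runs q φ (p b) (setStack s q []) t Q) :
      Runs q φ (.ask p) s (t + 1) Q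

namespace Runs

variable {K : Type} [DecidableEq K] {σ : Type*} [StackStore K σ] {q k : K} {φ : PromiseProblem}
  {p p' : Prog K} {s s' : σ} {t u : ℕ} {Q R : σ → Prop} {b : Bool}

theorem imp (h : Runs q φ p s t Q) (hQ : ∀ s', Q s' → R s') : Runs q φ p s t R := by
  induction h with
  | skip h => exact .skip (hQ _ h)
  | push _ ih => exact .push (ih hQ)
  | pop _ ih => exact .pop (ih hQ)
  | seq h _ _ ih' => exact .seq h fun s' hs => ih' s' hs hQ
  | loop_nil hs h => exact .loop_nil hs (hQ _ h)
  | loop_cons hs h _ _ ih' => exact .loop_cons hs h fun s' hs => ih' s' hs hQ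
  | ask w hw _ ih => exact .ask w hw fun b hb => ih b hb hQ

theorem add_time (h : Runs q φ p s t Q) (d : ℕ) : Runs q φ p s (d + t) Q := by
  induction h with
  | skip h => exact .skip h
  | push _ ih => exact .push ih
  | pop _ ih => exact .pop ih
  | seq h _ _ ih' => exact Nat.add_left_comm .. ▸ .seq h ih'
  | loop_nil hs h => exact .loop_nil hs h
  | loop_cons hs h _ _ ih' =>
    rw [← Nat.add_assoc, Nat.add_left_comm]
    exact .loop_cons hs h ih'
  | ask w hw _ ih => exact .ask w hw ih

theorem mono (h : Runs q φ p s t Q) (htu : t ≤ u) : Runs q φ p s u Q :=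
  Nat.sub_add_cancel htu ▸ h.add_time (u - t)

theorem seq_eq (h : Runs q φ p s t (· = s')) (h' : Runs q φ p' s' u Q) :
    Runs q φ (.seq p p') s (t + u) Q :=
  h.seq fun _ e => e ▸ h'

theorem length_le (h : Runs q φ p s t Q) {n : ℕ} (hn : ∀ k, (stack s k).length ≤ n) :
    Runs q φ p s t fun s' => Q s' ∧ ∀ k, (stack s' k).length ≤ n + t := by
  induction h generalizing n with
  | skip h => exact .skip ⟨h, fun k => (hn k).trans (by omega)⟩
  | @push k b _ s _ _ _ ih =>
    refine .push ((ih (n := n + 1) (length_stack_setStack_le (fun j => (hn j).trans n.le_succ)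
      (b :: stack s k) (Nat.succ_le_succ (hn k)) k)).imp fun _ h =>
        ⟨h.1, fun j => (h.2 j).trans (by omega)⟩)
  | @pop k _ s _ _ _ ih =>
    have htail : (stack s k).tail.length ≤ n :=
      (List.length_tail ▸ Nat.sub_le ..).trans (hn k)
    exact .pop ((ih (length_stack_setStack_le hn _ htail k)).imp fun _ h =>
      ⟨h.1, fun j => (h.2 j).trans (by omega)⟩)
  | seq _ _ ih ih' =>
    exact .seq (ih hn) fun _ hs => (ih' _ hs.1 hs.2).imp fun _ h =>
      ⟨h.1, fun j => (h.2 j).trans (by omega)⟩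
  | loop_nil hs h => exact .loop_nil hs ⟨h, fun k => (hn k).trans (by omega)⟩
  | @loop_cons k _ _ _ _ _ b l _ hs _ _ ih ih' =>
    have hl : l.length ≤ n := by
      have := hn k
      rw [hs, List.length_cons] at this
      omega
    exact .loop_cons hs (ih (length_stack_setStack_le hn l hl k)) fun _ hs =>
      (ih' _ hs.1 hs.2).imp fun _ h => ⟨h.1, fun j => (h.2 j).trans (by omega)⟩
  | ask w hw _ ih =>
    exact .ask w hw fun b hb =>
      (ih b hb (length_stack_setStack_le hn [] n.zero_le q)).imp fun _ h =>
        ⟨h.1, fun j => (h.2 j).trans (by omega)⟩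

end Runs

section Rules

variable {K : Type} [DecidableEq K] {σ : Type*} [StackStore K σ] {q k : K} {φ : PromiseProblem}
  {p : Prog K} {s : σ} {t : ℕ} {Q : σ → Prop} {b : Bool}

theorem runs_skip_iff : Runs q φ .skip s (t + 1) Q ↔ Q s :=
  ⟨fun h => by cases h; assumption, .skip⟩

theorem runs_push_iff :
    Runs q φ (.push k b p) s (t + 1) Q ↔ Runs q φ p (setStack s k (b :: stack s k)) t Q :=
  ⟨fun h => by cases h; assumption, .push⟩

theorem runs_pop_iff {p : Option Bool → Prog K} : Runs q φ (.pop k p) s (t + 1) Q ↔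
    Runs q φ (p (stack s k).head?) (setStack s k (stack s k).tail) t Q :=
  ⟨fun h => by cases h; assumption, .pop⟩

end Rules

/-! ### The machine of a program -/

namespace Prog

variable {K : Type}

/-- The labels of the machine for a program. -/
def Label : Prog K → Type
  | skip => Unit
  | push _ _ p => Option (Label p)
  | pop _ p => Option (Σ o, Label (p o))
  | seq p p' => Label p ⊕ Label p'
  | loop _ p => Option (Σ b, Label (p b))
  | ask p => Option (Σ b, Label (p b))

instance fintypeLabel : (p : Prog K) → Fintype (Label p)
  | skip => inferInstanceAs (Fintype Unit)
  | push _ _ p => @instFintypeOption _ (fintypeLabel p)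
  | pop _ p => @instFintypeOption _ (@Sigma.instFintype _ _ (fun o => fintypeLabel (p o)) _)
  | seq p p' => @instFintypeSum _ _ (fintypeLabel p) (fintypeLabel p')
  | loop _ p => @instFintypeOption _ (@Sigma.instFintype _ _ (fun b => fintypeLabel (p b)) _)
  | ask p => @instFintypeOption _ (@Sigma.instFintype _ _ (fun b => fintypeLabel (p b)) _)

/-- The label at which a program starts. -/
def entry : (p : Prog K) → Label p
  | skip => ()
  | push _ _ _ => (none : Option _)
  | pop _ _ => (none : Option _)
  | seq p _ => .inl (entry p)
  | loop _ _ => (none : Option _)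
  | ask _ => (none : Option _)

/-- What a machine does at a label: a statement or a query. -/
abbrev Action (K Λ : Type) : Type :=
  TM2.Stmt (fun _ : K => Bool) Λ (Option Bool) × Option (Bool → Λ)

/-- The actions of a program whose labels are embedded by `e` and which continues at `x`. -/
def actions {Λ : Type} : (p : Prog K) → (e : Label p → Λ) → (x : Λ) → Label p → Action K Λ
  | skip, _, x, _ => (.goto fun _ => x, none)
  | push k b p, e, _, none => (.push k (fun _ => b) (.goto fun _ => e (some (entry p))), none)
  | push _ _ p, e, x, some l => actions p (fun l => e (some l)) x l
  | pop k p, e, _, none => (.pop k (fun _ o => o) (.goto fun o => e (some ⟨o, entry (p o)⟩)), none)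
  | pop _ p, e, x, some ⟨o, l⟩ => actions (p o) (fun l => e (some ⟨o, l⟩)) x l
  | seq p p', e, _, .inl l => actions p (fun l => e (.inl l)) (e (.inr (entry p'))) l
  | seq _ p', e, x, .inr l => actions p' (fun l => e (.inr l)) x l
  | loop k p, e, x, none => (.pop k (fun _ o => o)
      (.goto fun o => o.elim x fun b => e (some ⟨b, entry (p b)⟩)), none)
  | loop _ p, e, _, some ⟨b, l⟩ => actions (p b) (fun l => e (some ⟨b, l⟩)) (e none) l
  | ask p, e, _, none => (.halt, some fun b => e (some ⟨b, entry (p b)⟩))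
  | ask p, e, x, some ⟨b, l⟩ => actions (p b) (fun l => e (some ⟨b, l⟩)) x l

end Prog

namespace OracleTM

variable {K : Type} [DecidableEq K] [Fintype K] (k₀ k₁ q : K)

/-- The oracle machine with the given actions. -/
def ofActions {Λ : Type} [Fintype Λ] (main : Λ) (a : Λ → Prog.Action K Λ) : OracleTM where
  tm :=
    { K := K
      k₀ := k₀
      k₁ := k₁
      Γ := fun _ => Bool
      Λ := Λ
      main := main
      σ := Option Bool
      initialState := none
      Γk₀Fin := inferInstanceAs (Fintype Bool)
      m := fun l => (a l).1 }
  inputAlphabet := Equiv.refl Bool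
  outputAlphabet := Equiv.refl Bool
  queryStack := q
  queryAlphabet := Equiv.refl Bool
  query := fun l => (a l).2

/-- The oracle machine that runs a program and halts, the label `none` being the halting one. -/
def ofProg (p : Prog K) : OracleTM :=
  ofActions k₀ k₁ q (Λ := Option p.Label) (some p.entry) fun
    | none => (.load (fun _ => none) .halt, none)
    | some l => p.actions some none l

variable {k₀ k₁ q} {φ : PromiseProblem} {t : ℕ}

theorem leads_ofActions {Λ : Type} [Fintype Λ] {main : Λ} {a : Λ → Prog.Action K Λ}
    {P : (ofActions k₀ k₁ q main a).tm.Cfg → Prop} {l : Λ}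
    {st : TM2.Stmt (fun _ : K => Bool) Λ (Option Bool)} (hl : a l = (st, none)) {v : Option Bool}
    {S : K → List Bool} {c : TM2.Cfg (fun _ : K => Bool) Λ (Option Bool)}
    (hc : TM2.stepAux st v S = c) (h : Leads (ofActions k₀ k₁ q main a) φ P t c) :
    Leads (ofActions k₀ k₁ q main a) φ P (t + 1) ⟨some l, v, S⟩ :=
  leads_compute (M := ofActions k₀ k₁ q main a) (congrArg Prod.snd hl)
    ((congrArg (fun act => TM2.stepAux act.1 v S) hl).trans hc) h

theorem ofProg_init (p : Prog K) (x : Word) : (ofProg k₀ k₁ q p).init x =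
    ⟨some (some p.entry), none, Function.update (fun _ => []) k₀ x.1⟩ := by
  rw [init_eq]
  exact congrArg (fun l => (⟨some (some p.entry), none, Function.update (fun _ => []) k₀ l⟩ :
    TM2.Cfg (fun _ : K => Bool) _ (Option Bool))) (List.map_id x.1)

end OracleTM

section Leads

variable {K : Type} [DecidableEq K] {σ : Type*} [StackStore K σ] {k₀ k₁ q : K}
  {φ : PromiseProblem} {p : Prog K} {s : σ} {t : ℕ} {Q : σ → Prop}

open OracleTM

theorem cfg_setStack {Λ : Type} (l : Option Λ) (v : Option Bool) (s : σ) (k : K) (bs : List Bool) :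
    (⟨l, v, Function.update (stack s) k bs⟩ : TM2.Cfg (fun _ : K => Bool) Λ (Option Bool)) =
      ⟨l, v, stack (setStack s k bs)⟩ :=
  congrArg (TM2.Cfg.mk l v) (stack_setStack s k bs).symm

theorem stepAux_pop_goto {Λ : Type} {k : K} {bs : List Bool} (hs : stack s k = bs)
    (f : Option Bool → Λ) (v : Option Bool) :
    TM2.stepAux (.pop k (fun _ o => o) (.goto f)) v (stack s) =
      ⟨some (f bs.head?), bs.head?, stack (setStack s k bs.tail)⟩ := by
  subst hs
  exact cfg_setStack ..

variable [Fintype K]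

theorem Runs.leads {Λ : Type} [Fintype Λ] {main : Λ} {a : Λ → Prog.Action K Λ}
    (h : Runs q φ p s t Q) (e : p.Label → Λ) (x : Λ) (ha : ∀ l, a (e l) = p.actions e x l)
    (v : Option Bool) :
    Leads (ofActions k₀ k₁ q main a) φ (fun c => ∃ v s', Q s' ∧ c = ⟨some x, v, stack s'⟩) t
      ⟨some (e p.entry), v, stack s⟩ := by
  induction h generalizing x v with
  | skip h => exact leads_ofActions (ha ()) rfl (.done _ _ ⟨_, _, h, rfl⟩)
  | push _ ih =>
    exact leads_ofActions (ha (none : Option _)) (cfg_setStack ..)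
      (ih (fun l => e (some l)) x (fun l => ha (some l)) v)
  | pop _ ih =>
    exact leads_ofActions (ha (none : Option _)) (stepAux_pop_goto rfl ..)
      (ih (fun l => e (some ⟨_, l⟩)) x (fun l => ha (some ⟨_, l⟩)) _)
  | seq _ _ ih ih' =>
    refine (ih (fun l => e (.inl l)) _ (fun l => ha (.inl l)) v).trans ?_
    rintro _ ⟨v', s', hs', rfl⟩
    exact ih' s' hs' (fun l => e (.inr l)) _ (fun l => ha (.inr l)) v'
  | @loop_nil k _ s _ _ hs h =>
    refine leads_ofActions (ha (none : Option _)) (stepAux_pop_goto hs ..)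
      (.done _ _ ⟨none, setStack s k [], ?_, rfl⟩)
    rwa [← hs, setStack_stack]
  | @loop_cons _ _ _ _ _ _ b _ _ hs _ _ ih ih' =>
    refine leads_ofActions (ha (none : Option _)) (stepAux_pop_goto hs ..)
      ((ih (fun l => e (some ⟨b, l⟩)) (e (none : Option _)) (fun l => ha (some ⟨b, l⟩))
        (some b)).trans ?_)
    rintro _ ⟨v', s', hs', rfl⟩
    exact ih' s' hs' e x ha v'
  | ask w hw _ ih =>
    refine leads_ask (M := ofActions k₀ k₁ q main a) (congrArg Prod.snd (ha (none : Option _)))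
      (w := w) ((List.map_id _).trans hw) fun b hb => ?_
    exact (congrArg (Leads (ofActions k₀ k₁ q main a) φ _ _) (cfg_setStack ..)).mpr
      (ih b hb (fun l => e (some ⟨b, l⟩)) x (fun l => ha (some ⟨b, l⟩)) v)

theorem Runs.leads_ofProg {A : Set Bool} {x : Word}
    (h : Runs q φ p s t fun s' => ∃ b ∈ A, stack s' = Function.update (fun _ => []) k₁ [b])
    (hs : stack s = Function.update (fun _ => []) k₀ x.1) :
    Leads (ofProg k₀ k₁ q p) φ (fun c => ∃ b ∈ A, c = (ofProg k₀ k₁ q p).halted b) (t + 1)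
      ((ofProg k₀ k₁ q p).init x) := by
  rw [(ofProg_init p x).trans (congrArg (TM2.Cfg.mk (Γ := fun _ : K => Bool) _ _) hs.symm)]
  refine (h.leads some none (fun _ => rfl) none).trans ?_
  rintro _ ⟨v, s', ⟨b, hb, hs'⟩, rfl⟩
  refine leads_compute (M := ofProg k₀ k₁ q p) rfl rfl (.done _ _ ⟨b, hb, ?_⟩)
  exact (congrArg (TM2.Cfg.mk (Γ := fun _ : K => Bool) none none) hs').trans
    (halted_eq _ b).symm

end Leads

section Drain

variable {K : Type} [DecidableEq K] {σ : Type*} [StackStore K σ] {q k : K} {φ : PromiseProblem}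

/-- Empty all the given stacks. -/
def Prog.drain : List K → Prog K
  | [] => skip
  | k :: ks => seq (loop k fun _ => skip) (drain ks)

theorem Runs.loop_skip (n : ℕ) (s : σ) (hn : (stack s k).length ≤ n) :
    Runs q φ (.loop k fun _ => .skip) s (2 * n + 1) (· = setStack s k []) := by
  induction n generalizing s with
  | zero =>
    have hs : stack s k = [] := by simpa using hn
    exact .loop_nil hs (by rw [← hs, setStack_stack])
  | succ n ih =>
    rcases hs : stack s k with _ | ⟨b, l⟩
    · exact .loop_nil hs (by rw [← hs, setStack_stack])
    · refine Runs.mono (.loop_cons (t := 1) (u := 2 * n + 1) (R := (· = setStack s k l)) hs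
        (.skip rfl) ?_) (by omega)
      rintro _ rfl
      refine (ih _ (by simpa [hs, stack_setStack_self] using hn)).imp ?_
      simp only [setStack_setStack, imp_self, implies_true]

theorem Runs.drain (n : ℕ) (ks : List K) (s : σ) (hn : ∀ k, (stack s k).length ≤ n) :
    Runs q φ (.drain ks) s (ks.length * (2 * n + 1) + 1)
      fun s' => stack s' = fun k => if k ∈ ks then [] else stack s k := by
  induction ks generalizing s with
  | nil => exact .skip (by simp)
  | cons k ks ih =>
    have htime : 2 * n + 1 + (ks.length * (2 * n + 1) + 1) =
        (k :: ks).length * (2 * n + 1) + 1 := by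
      rw [List.length_cons]
      ring
    refine htime ▸ (Runs.loop_skip n s (hn k)).seq_eq
      ((ih _ (length_stack_setStack_le hn [] n.zero_le k)).imp fun s' hs' => hs'.trans ?_)
    funext j
    obtain rfl | h := eq_or_ne j k
    · simp [stack_setStack_self]
    · simp [h, stack_setStack_of_ne]

theorem weakReduces_of_runs [Finite K] {φ₁ φ₂ : PromiseProblem} (k₀ k₁ q : K) (p : Prog K)
    (T : Polynomial ℕ) (s₀ : Word → σ)
    (hs₀ : ∀ x, stack (s₀ x) = Function.update (fun _ => []) k₀ x.1)
    (h : ∀ x : Word, Runs q φ₂ p (s₀ x) (T.eval x.1.length)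
      fun s => ∃ b ∈ (φ₁ x : Set Bool), stack s k₁ = [b]) : WeakReduces φ₁ φ₂ := by
  have := Fintype.ofFinite K
  set ks : List K := (Finset.univ.erase k₁).toList with hks
  refine ⟨OracleTM.ofProg k₀ k₁ q (.seq p (.drain ks)),
    T + (.C ks.length * (2 * (.X + T) + 1) + 1) + 1, fun x => ?_⟩
  have hlen (k : K) : (stack (s₀ x) k).length ≤ x.1.length := by
    rw [hs₀]
    obtain rfl | hk := eq_or_ne k k₀ <;> simp [*]
  have hruns : Runs q φ₂ (.seq p (.drain ks)) (s₀ x)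
      (T.eval x.1.length + (ks.length * (2 * (x.1.length + T.eval x.1.length) + 1) + 1))
      fun s => ∃ b ∈ (φ₁ x : Set Bool), stack s = Function.update (fun _ => []) k₁ [b] := by
    refine ((h x).length_le hlen).seq fun s hs => (Runs.drain _ ks s hs.2).imp fun s' hs' => ?_
    obtain ⟨⟨b, hb, hsb⟩, -⟩ := hs
    refine ⟨b, hb, hs'.trans ?_⟩
    funext k
    obtain rfl | hk := eq_or_ne k k₁ <;> simp [*]
  rw [OracleTM.allPaths_iff_leads]
  simpa using hruns.leads_ofProg (hs₀ x)

end Drain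

/-! ### Alternating quantifiers -/

theorem sat_coSat_not {ms : List ℕ} {f : List (List Bool) → Bool} :
    (Sat ms (fun ys => !f ys) ↔ ¬ CoSat ms f) ∧ (CoSat ms (fun ys => !f ys) ↔ ¬ Sat ms f) := by
  induction ms generalizing f with
  | nil => simp [Sat, CoSat]
  | cons m ms ih =>
    simp only [Sat, CoSat, not_forall, not_exists, not_and, exists_prop]
    exact ⟨exists_congr fun x => and_congr_right fun _ => ih.2,
      forall_congr' fun x => imp_congr_right fun _ => ih.1⟩

theorem sat_coSat_const (ms : List ℕ) (c : Bool) :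
    (Sat ms (fun _ => c) ↔ c = true) ∧ (CoSat ms (fun _ => c) ↔ c = true) := by
  induction ms with
  | nil => simp [Sat, CoSat]
  | cons m ms ih =>
    have hm : ∃ x : List Bool, x.length = m := ⟨List.replicate m true, List.length_replicate⟩
    simp only [Sat, CoSat, ih]
    exact ⟨by simp [hm], fun h => hm.elim h, fun h _ _ => h⟩

theorem sat_coSat_append {ms : List ℕ} (ls : List ℕ) {f : List (List Bool) → Bool}
    (h : ∀ ys zs, ys.length = ms.length → f (ys ++ zs) = f ys) :
    (Sat (ms ++ ls) f ↔ Sat ms f) ∧ (CoSat (ms ++ ls) f ↔ CoSat ms f) := by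
  induction ms generalizing f with
  | nil =>
    have hf : f = fun _ => f [] := funext fun zs => h [] zs rfl
    rw [hf]
    simpa only [List.nil_append, Sat, CoSat] using sat_coSat_const ls (f [])
  | cons m ms ih =>
    have h' (x : List Bool) := ih (f := fun ys => f (x :: ys)) fun ys zs hys =>
      h (x :: ys) zs (by simp [hys])
    simp only [List.cons_append, Sat, CoSat]
    exact ⟨exists_congr fun x => and_congr_right fun _ => (h' x).2,
      forall_congr' fun x => imp_congr_right fun _ => (h' x).1⟩

/-! ### Boolean expressions with constants -/

/-- The tokens of Boolean expressions with constants. A variable is the token `var` followed by the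
bits of its two unary indices. -/
inductive Tok : Type
  | neg | and | or | var
  | const (c : Bool)
  | bit (b : Bool)
  deriving DecidableEq

/-- The bits of a unary number as tokens. -/
def bitToks (l : List Bool) : List Tok := l.map .bit

/-- Boolean expressions with constants, which arise when variables are fixed. -/
inductive XExpr : Type
  | const (c : Bool) : XExpr
  | var (i j : ℕ) : XExpr
  | neg (f : XExpr) : XExpr
  | and (f g : XExpr) : XExpr
  | or (f g : XExpr) : XExpr

namespace XExpr

/-- The value of an expression. -/
def eval : XExpr → List (List Bool) → Bool
  | const c, _ => c
  | var i j, ys => (ys.getD i []).getD j false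
  | neg f, ys => !f.eval ys
  | and f g, ys => f.eval ys && g.eval ys
  | or f g, ys => f.eval ys || g.eval ys

/-- All variables belong to blocks of the sizes `ms`. -/
def WF (ms : List ℕ) : XExpr → Prop
  | const _ => True
  | var i j => j < ms.getD i 0
  | neg f => f.WF ms
  | and f g => f.WF ms ∧ g.WF ms
  | or f g => f.WF ms ∧ g.WF ms

/-- The tokens of an expression. -/
def toks : XExpr → List Tok
  | const c => [.const c]
  | var i j => .var :: bitToks (unary i ++ unary j)
  | neg f => .neg :: f.toks
  | and f g => .and :: (f.toks ++ g.toks)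
  | or f g => .or :: (f.toks ++ g.toks)

/-- The inclusion of the expressions without constants. -/
def ofBool : BoolExpr → XExpr
  | .var i j => var i j
  | .neg f => neg (ofBool f)
  | .and f g => and (ofBool f) (ofBool g)
  | .or f g => or (ofBool f) (ofBool g)

/-- The expression with its constants expressed by the first variable, as expressions in an oracle
query have no constants. -/
def toBool : XExpr → BoolExpr
  | const true => .or (.var 0 0) (.neg (.var 0 0))
  | const false => .and (.var 0 0) (.neg (.var 0 0))
  | var i j => .var i j
  | neg f => .neg f.toBool
  | and f g => .and f.toBool g.toBool
  | or f g => .or f.toBool g.toBool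

/-- The first variable of the first block fixed to `b`. -/
def subst (b : Bool) : XExpr → XExpr
  | const c => const c
  | var 0 0 => const b
  | var 0 (j + 1) => var 0 j
  | var (i + 1) j => var (i + 1) j
  | neg f => neg (f.subst b)
  | and f g => and (f.subst b) (g.subst b)
  | or f g => or (f.subst b) (g.subst b)

/-- The exhausted first block removed. -/
def shift : XExpr → XExpr
  | const c => const c
  | var 0 _ => const false
  | var (i + 1) j => var i j
  | neg f => neg f.shift
  | and f g => and f.shift g.shift
  | or f g => or f.shift g.shift

theorem eval_ofBool (f : BoolExpr) (ys : List (List Bool)) : (ofBool f).eval ys = f.eval ys := by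
  induction f <;> simp_all [ofBool, eval, BoolExpr.eval]

theorem wf_ofBool (f : BoolExpr) (ms : List ℕ) : (ofBool f).WF ms ↔ f.WellFormed ms := by
  induction f <;> simp_all [ofBool, WF, BoolExpr.WellFormed]

theorem eval_toBool (f : XExpr) (ys : List (List Bool)) : f.toBool.eval ys = f.eval ys := by
  induction f with
  | const c => cases c <;> simp [toBool, eval, BoolExpr.eval]
  | _ => simp_all [toBool, eval, BoolExpr.eval]

theorem wf_toBool (f : XExpr) {m : ℕ} {ms ls : List ℕ} (h : f.WF ((m + 1) :: ms)) :
    f.toBool.WellFormed ((m + 1) :: ms ++ ls) := by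
  induction f with
  | const c => cases c <;> simp [toBool, BoolExpr.WellFormed]
  | var i j =>
    simp only [WF, toBool, BoolExpr.WellFormed] at h ⊢
    by_cases hi : i < ((m + 1) :: ms).length
    · rwa [List.getD_append _ _ _ _ hi]
    · rw [List.getD_eq_default _ _ (by omega)] at h
      omega
  | neg f ih => exact ih h
  | and f g ihf ihg => exact ⟨ihf h.1, ihg h.2⟩
  | or f g ihf ihg => exact ⟨ihf h.1, ihg h.2⟩

theorem eval_append (f : XExpr) {ms : List ℕ} (h : f.WF ms) (ys zs : List (List Bool))
    (hys : ys.length = ms.length) : f.eval (ys ++ zs) = f.eval ys := by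
  induction f with
  | const c => rfl
  | var i j =>
    simp only [WF, eval] at h ⊢
    by_cases hi : i < ms.length
    · rw [List.getD_append _ _ _ _ (by omega)]
    · rw [List.getD_eq_default _ _ (by omega)] at h
      omega
  | neg f ih => simp [eval, ih h]
  | and f g ihf ihg => simp [eval, ihf h.1, ihg h.2]
  | or f g ihf ihg => simp [eval, ihf h.1, ihg h.2]

theorem eval_subst (b : Bool) (f : XExpr) (x : List Bool) (ys : List (List Bool)) :
    (f.subst b).eval (x :: ys) = f.eval ((b :: x) :: ys) := by
  induction f with
  | var i j => rcases i with _ | i <;> rcases j with _ | j <;> simp [subst, eval]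
  | _ => simp_all [subst, eval]

theorem wf_subst (b : Bool) (f : XExpr) (m : ℕ) (ms : List ℕ) :
    (f.subst b).WF (m :: ms) ↔ f.WF ((m + 1) :: ms) := by
  induction f with
  | var i j => rcases i with _ | i <;> rcases j with _ | j <;> simp [subst, WF]
  | _ => simp_all [subst, WF]

theorem eval_shift (f : XExpr) (ys : List (List Bool)) : f.shift.eval ys = f.eval ([] :: ys) := by
  induction f with
  | var i j => rcases i with _ | i <;> simp [shift, eval]
  | _ => simp_all [shift, eval]

/-- What is pushed on the stack of errors when the exhausted first block is removed. -/
def shiftErrors : XExpr → List Bool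
  | const _ => []
  | var 0 _ => [true]
  | var (_ + 1) _ => []
  | neg f => f.shiftErrors
  | and f g => g.shiftErrors ++ f.shiftErrors
  | or f g => g.shiftErrors ++ f.shiftErrors

/-- The tokens that result when the exhausted first block is removed. -/
def shiftToks : XExpr → List Tok
  | const c => [.const c]
  | var 0 j => bitToks (unary j)
  | var (i + 1) j => (var i j).toks
  | neg f => .neg :: f.shiftToks
  | and f g => .and :: (f.shiftToks ++ g.shiftToks)
  | or f g => .or :: (f.shiftToks ++ g.shiftToks)

/-- What is pushed on the stack of errors when an expression is evaluated. -/
def varErrors : XExpr → List Bool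
  | const _ => []
  | var _ _ => [true]
  | neg f => f.varErrors
  | and f g => f.varErrors ++ g.varErrors
  | or f g => f.varErrors ++ g.varErrors

theorem shiftToks_eq (f : XExpr) (h : f.shiftErrors = []) : f.shiftToks = f.shift.toks := by
  induction f with
  | var i j => rcases i with _ | i <;> simp_all [shiftErrors, shiftToks, shift]
  | _ => simp_all [shiftErrors, shiftToks, shift, toks]

theorem wf_zero_cons (f : XExpr) (ms : List ℕ) :
    f.WF (0 :: ms) ↔ f.shiftErrors = [] ∧ f.shift.WF ms := by
  induction f with
  | var i j => rcases i with _ | i <;> simp [shiftErrors, shift, WF]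
  | and f g ihf ihg =>
    simp only [shiftErrors, shift, WF, ihf, ihg, List.append_eq_nil_iff]
    tauto
  | or f g ihf ihg =>
    simp only [shiftErrors, shift, WF, ihf, ihg, List.append_eq_nil_iff]
    tauto
  | _ => simp_all [shiftErrors, shift, WF]

theorem wf_nil (f : XExpr) : f.WF [] ↔ f.varErrors = [] := by
  induction f <;> simp_all [varErrors, WF]

theorem length_toks_subst_le (b : Bool) (f : XExpr) :
    (f.subst b).toks.length ≤ f.toks.length := by
  induction f with
  | var i j =>
    rcases i with _ | i <;> rcases j with _ | j <;> simp [subst, toks, bitToks, unary]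
  | _ =>
    simp only [subst, toks, List.length_cons, List.length_append] at *
    omega

theorem length_shiftToks_le (f : XExpr) : f.shiftToks.length ≤ f.toks.length := by
  induction f with
  | var i j =>
    rcases i with _ | i <;> simp [shiftToks, toks, bitToks, unary]
  | _ =>
    simp only [shiftToks, toks, List.length_cons, List.length_append] at *
    omega

end XExpr

/-- The bits for a token in the encoding of an expression, constants being expressed by the first
variable. -/
def Tok.bits : Tok → List Bool
  | neg => [false, false]
  | and => [false, true]
  | or => [true, false]
  | var => [true, true]
  | const c => (XExpr.const c).toBool.encode
  | bit b => [b]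

theorem Tok.flatMap_bits_bitToks (l : List Bool) : (bitToks l).flatMap Tok.bits = l := by
  induction l with
  | nil => rfl
  | cons b l ih => simpa [bitToks, Tok.bits] using ih

theorem XExpr.encode_toBool (f : XExpr) : f.toBool.encode = f.toks.flatMap Tok.bits := by
  induction f with
  | const c => cases c <;> simp [toks, Tok.bits]
  | var i j =>
    simp [toks, toBool, BoolExpr.encode, Tok.bits, Tok.flatMap_bits_bitToks]
  | _ => simp_all [toks, toBool, BoolExpr.encode, Tok.bits]

/-! ### Self-reduction of `SATₙ` -/

theorem sat_cons_iff_subst {m : ℕ} {ms : List ℕ} {f : XExpr} {b : Bool}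
    (hb : Sat ((m + 1) :: ms) f.eval → b ∈ firstBits ((m + 1) :: ms) f.eval) :
    Sat ((m + 1) :: ms) f.eval ↔ Sat (m :: ms) (f.subst b).eval := by
  constructor
  · intro h
    obtain ⟨x, ⟨hx, hc⟩, hxb⟩ := hb h
    obtain ⟨y, rfl⟩ := List.head?_eq_some_iff.mp hxb
    exact ⟨y, by simpa using hx, by simpa only [f.eval_subst] using hc⟩
  · rintro ⟨y, hy, hc⟩
    exact ⟨b :: y, by simp [hy], by simpa only [f.eval_subst] using hc⟩

theorem sat_zero_cons {ms : List ℕ} {f : XExpr} :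
    Sat (0 :: ms) f.eval ↔ ¬ Sat ms (XExpr.neg f.shift).eval := by
  have hshift : f.shift.eval = fun ys => f.eval ([] :: ys) := funext f.eval_shift
  calc Sat (0 :: ms) f.eval ↔ CoSat ms f.shift.eval := by
        rw [hshift]
        simp only [Sat, List.length_eq_zero_iff, exists_eq_left]
    _ ↔ ¬ Sat ms (XExpr.neg f.shift).eval := iff_not_comm.mp sat_coSat_not.1

theorem mem_firstBits_of_mem_VAL {n : ℕ} (I : Instance n) (hn : n ≠ 0) {w : Word}
    (hw : I.encode = w.1) {b : Bool} (hb : b ∈ (VAL n w : Set Bool)) (h : Sat I.sizes I.fn) :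
    b ∈ firstBits I.sizes I.fn := by
  rw [VAL_encode I w hw, Instance.val, dif_pos ⟨hn, h⟩] at hb
  exact hb

namespace XExpr

variable {m : ℕ} {ms : List ℕ} {f : XExpr}

/-- The function of `f`, with `d` additional blocks of size 1 on which it does not depend. -/
def paddedInstance (hf : f.WF ((m + 1) :: ms)) (hms : ∀ k ∈ ms, 1 ≤ k) (d : ℕ) :
    Instance (ms.length + 1 + d) where
  sizes := (m + 1) :: ms ++ List.replicate d 1
  expr := f.toBool
  length_sizes := by simp [Nat.add_right_comm]
  one_le_sizes := by
    intro k hk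
    rcases List.mem_append.mp hk with hk | hk
    · rcases List.mem_cons.mp hk with rfl | hk
      exacts [m.succ_pos, hms k hk]
    · exact (List.eq_of_mem_replicate hk).ge
  wellFormed := f.wf_toBool hf

theorem fn_paddedInstance (hf : f.WF ((m + 1) :: ms)) (hms : ∀ k ∈ ms, 1 ≤ k) (d : ℕ) :
    (paddedInstance hf hms d).fn = f.eval :=
  funext f.eval_toBool

theorem encode_paddedInstance (hf : f.WF ((m + 1) :: ms)) (hms : ∀ k ∈ ms, 1 ≤ k) (d : ℕ) :
    (paddedInstance hf hms d).encode =
      ((m + 1) :: ms ++ List.replicate d 1).flatMap unary ++ f.toks.flatMap Tok.bits := by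
  rw [← encode_toBool]
  rfl

theorem sat_cons_iff_subst_of_mem_VAL {d : ℕ} {b : Bool} {w : Word} (hf : f.WF ((m + 1) :: ms))
    (hms : ∀ k ∈ ms, 1 ≤ k)
    (hw : w.1 = ((m + 1) :: ms ++ List.replicate d 1).flatMap unary ++ f.toks.flatMap Tok.bits)
    (hb : b ∈ (VAL (ms.length + 1 + d) w : Set Bool)) :
    Sat ((m + 1) :: ms) f.eval ↔ Sat (m :: ms) (f.subst b).eval := by
  have happend (ys zs : List (List Bool)) := f.eval_append hf ys zs
  have hmem := mem_firstBits_of_mem_VAL (paddedInstance hf hms d) (by omega)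
    ((encode_paddedInstance hf hms d).trans hw.symm) hb
  rw [fn_paddedInstance] at hmem
  refine sat_cons_iff_subst fun h => ?_
  obtain ⟨x, ⟨hx, hc⟩, hxb⟩ := hmem ((sat_coSat_append _ happend).1.mpr h)
  exact ⟨x, ⟨hx, (sat_coSat_append _ fun ys zs hys =>
    happend (x :: ys) zs (congrArg Nat.succ hys)).2.mp hc⟩, hxb⟩

end XExpr

/-! ### Basic programs -/

namespace Tok

/-- The three bits for a token on a stack. -/
def code : Tok → List Bool
  | neg => [false, false, false]
  | and => [false, false, true]
  | or => [false, true, false]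
  | var => [false, true, true]
  | const c => [true, false, c]
  | bit b => [true, true, b]

/-- The token with the given bits. -/
def decode : Bool → Bool → Bool → Tok
  | false, false, false => neg
  | false, false, true => and
  | false, true, false => or
  | false, true, true => var
  | true, false, c => const c
  | true, true, b => bit b

theorem exists_code_eq (t : Tok) : ∃ a b c, t.code = [a, b, c] ∧ decode a b c = t := by
  cases t <;> exact ⟨_, _, _, rfl, rfl⟩

end Tok

/-- A list of tokens as the contents of a stack. -/
def enc (ts : List Tok) : List Bool := ts.flatMap Tok.code

theorem enc_nil : enc [] = [] := rfl

theorem enc_cons (t : Tok) (ts : List Tok) : enc (t :: ts) = t.code ++ enc ts := rfl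

theorem enc_append (ts ts' : List Tok) : enc (ts ++ ts') = enc ts ++ enc ts' :=
  List.flatMap_append

namespace Prog

variable {K : Type}

/-- Push a list, its head on top. -/
def pushList (k : K) : List Bool → Prog K → Prog K
  | [], p => p
  | b :: l, p => pushList k l (push k b p)

/-- Push a token. -/
def pushTok (k : K) (t : Tok) (p : Prog K) : Prog K :=
  pushList k t.code p

/-- Pop a token; bits that are missing count as `0`. -/
def popTok (k : K) (p : Tok → Prog K) : Prog K :=
  pop k fun a => pop k fun b => pop k fun c =>
    p (.decode (a.getD false) (b.getD false) (c.getD false))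

/-- Pop and process tokens as long as there are any. -/
def loopTok (k : K) (p : Tok → Prog K) : Prog K :=
  loop k fun a => pop k fun b => pop k fun c => p (.decode a (b.getD false) (c.getD false))

/-- Move a stack onto another, which reverses it. -/
def move (k j : K) : Prog K := loop k fun b => push j b skip

/-- Move a stack of tokens onto another, which reverses their order. -/
def moveTok (k j : K) : Prog K := loopTok k fun t => pushTok j t skip

end Prog

section BasicPrograms

variable {K : Type} [DecidableEq K] {σ : Type*} [StackStore K σ] {q k j : K} {φ : PromiseProblem}
  {s : σ} {t u : ℕ} {Q R : σ → Prop} {l : List Bool}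

theorem Runs.pushList {p : Prog K} (h : Runs q φ p (setStack s k (l ++ stack s k)) u Q) :
    Runs q φ (.pushList k l p) s (u + l.length) Q := by
  induction l generalizing p u with
  | nil =>
    rw [List.nil_append, setStack_stack] at h
    exact h
  | cons b l ih =>
    have hpush : Runs q φ (.push k b p) (setStack s k (l ++ stack s k)) (u + 1) Q := by
      rw [runs_push_iff, setStack_setStack, stack_setStack_self]
      exact h
    exact (ih hpush).mono (by rw [List.length_cons]; omega)

theorem runs_pushTok_iff {p : Prog K} {a : Tok} : Runs q φ (.pushTok k a p) s (u + 3) Q ↔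
    Runs q φ p (setStack s k (a.code ++ stack s k)) u Q := by
  obtain ⟨x, y, z, ha, -⟩ := a.exists_code_eq
  simp only [Prog.pushTok, ha, Prog.pushList, runs_push_iff, setStack_setStack, stack_setStack_self,
    List.cons_append, List.nil_append]

theorem runs_popTok_iff {p : Tok → Prog K} {a : Tok} (h : stack s k = a.code ++ l) :
    Runs q φ (.popTok k p) s (u + 3) Q ↔ Runs q φ (p a) (setStack s k l) u Q := by
  obtain ⟨x, y, z, ha, rfl⟩ := a.exists_code_eq
  simp [Prog.popTok, runs_pop_iff, setStack_setStack, stack_setStack_self, h, ha]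

theorem Runs.loopTok_nil {p : Tok → Prog K} (hs : stack s k = []) (h : Q s) :
    Runs q φ (.loopTok k p) s (t + 1) Q :=
  .loop_nil hs h

theorem Runs.loopTok_cons {p : Tok → Prog K} {a : Tok} (hs : stack s k = a.code ++ l)
    (h : Runs q φ (p a) (setStack s k l) t R)
    (h' : ∀ s', R s' → Runs q φ (.loopTok k p) s' u Q) :
    Runs q φ (.loopTok k p) s (u + (t + 3)) Q := by
  obtain ⟨x, y, z, ha, rfl⟩ := a.exists_code_eq
  rw [ha] at hs
  refine (Runs.loop_cons (t := t + 2) hs (R := R) ?_ h').mono (by omega)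
  rw [runs_pop_iff, runs_pop_iff]
  simpa [setStack_setStack, stack_setStack_self] using h

theorem setStack_setStack_of_nil (hk : stack s k = []) (j : K) :
    setStack (setStack s k []) j (stack s j) = s := by
  rw [← hk, setStack_stack, setStack_stack]

theorem Runs.move (hkj : k ≠ j) (n : ℕ) (hn : (stack s k).length ≤ n) :
    Runs q φ (.move k j) s (3 * n + 1)
      (· = setStack (setStack s k []) j ((stack s k).reverse ++ stack s j)) := by
  induction n generalizing s with
  | zero =>
    have hk : stack s k = [] := by simpa using hn
    refine .loop_nil hk ?_
    rw [hk, List.reverse_nil, List.nil_append, setStack_setStack_of_nil hk]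
  | succ n ih =>
    rcases hk : stack s k with _ | ⟨b, l⟩
    · refine .loop_nil hk ?_
      rw [List.reverse_nil, List.nil_append, setStack_setStack_of_nil hk]
    · refine (Runs.loop_cons (t := 2) (u := 3 * n + 1) hk
        (R := (· = setStack (setStack s k l) j (b :: stack s j))) ?_ ?_).mono (by omega)
      · rw [runs_push_iff, runs_skip_iff, stack_setStack_of_ne _ _ hkj.symm]
      · rintro _ rfl
        have hl : stack (setStack (setStack s k l) j (b :: stack s j)) k = l := by
          rw [stack_setStack_of_ne _ _ hkj, stack_setStack_self]
        refine (ih (by rw [hl]; simpa [hk] using hn)).imp ?_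
        rintro _ rfl
        rw [hl, stack_setStack_self, setStack_comm _ _ _ hkj, setStack_setStack, setStack_setStack,
          List.reverse_cons, List.append_assoc, List.singleton_append]

theorem Runs.moveTok (hkj : k ≠ j) (ts ts' : List Tok) (hk : stack s k = enc ts)
    (hj : stack s j = enc ts') :
    Runs q φ (.moveTok k j) s (7 * ts.length + 1)
      (· = setStack (setStack s k []) j (enc (ts.reverse ++ ts'))) := by
  induction ts generalizing s ts' with
  | nil =>
    refine .loopTok_nil hk ?_
    rw [List.reverse_nil, List.nil_append, ← hj, setStack_setStack_of_nil hk]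
  | cons a ts ih =>
    refine (Runs.loopTok_cons (t := 4) (u := 7 * ts.length + 1) (hk.trans (enc_cons _ _))
      (R := (· = setStack (setStack s k (enc ts)) j (enc (a :: ts')))) ?_ ?_).mono
      (by simp only [List.length_cons]; omega)
    · rw [runs_pushTok_iff, runs_skip_iff, stack_setStack_of_ne _ _ hkj.symm, hj, enc_cons]
    · rintro _ rfl
      refine (ih (ts' := a :: ts') ?_ (stack_setStack_self ..)).imp ?_
      · rw [stack_setStack_of_ne _ _ hkj, stack_setStack_self]
      · rintro _ rfl
        rw [setStack_comm _ _ _ hkj, setStack_setStack, setStack_setStack, List.reverse_cons,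
          List.append_assoc, List.singleton_append]

end BasicPrograms

/-! ### The stacks of the two reductions -/

/-- The names of the stacks: the input, the query, the block sizes, scratch space, the expression,
the expression in reverse, errors, values of subexpressions, the blocks still to be read, the
rounds still to be played, and the output. -/
inductive Stk : Type
  | inp | qry | hdr | tmp | body | aux | bad | val | grd | rnd | out
  deriving DecidableEq

instance : Fintype Stk where
  elems := {.inp, .qry, .hdr, .tmp, .body, .aux, .bad, .val, .grd, .rnd, .out}
  complete k := by cases k <;> decide

/-- The contents of the stacks. This is a record, so that a state in a proof can name the stacks
that differ from those of another state. -/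
@[ext]
structure Store : Type where
  inp : List Bool
  qry : List Bool
  hdr : List Bool
  tmp : List Bool
  body : List Bool
  aux : List Bool
  bad : List Bool
  val : List Bool
  grd : List Bool
  rnd : List Bool
  out : List Bool

namespace Store

/-- The contents of a stack. -/
def get (S : Store) : Stk → List Bool
  | .inp => S.inp
  | .qry => S.qry
  | .hdr => S.hdr
  | .tmp => S.tmp
  | .body => S.body
  | .aux => S.aux
  | .bad => S.bad
  | .val => S.val
  | .grd => S.grd
  | .rnd => S.rnd
  | .out => S.out

/-- Replacement of the contents of a stack. -/
def set (S : Store) (k : Stk) (l : List Bool) : Store :=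
  match k with
  | .inp => { S with inp := l }
  | .qry => { S with qry := l }
  | .hdr => { S with hdr := l }
  | .tmp => { S with tmp := l }
  | .body => { S with body := l }
  | .aux => { S with aux := l }
  | .bad => { S with bad := l }
  | .val => { S with val := l }
  | .grd => { S with grd := l }
  | .rnd => { S with rnd := l }
  | .out => { S with out := l }

theorem get_set (S : Store) (k : Stk) (l : List Bool) :
    (S.set k l).get = Function.update S.get k l := by
  funext j
  cases k <;> cases j <;> rfl

theorem get_injective : Function.Injective get := by
  intro S T h
  have h' (k) := congrFun h k
  ext1
  exacts [h' .inp, h' .qry, h' .hdr, h' .tmp, h' .body, h' .aux, h' .bad, h' .val, h' .grd, h' .rnd,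
    h' .out]

instance : StackStore Stk Store where
  stack := get
  setStack := set
  stack_injective := get_injective
  stack_setStack := get_set

@[simp]
theorem stack_eq (S : Store) : stack S = S.get := rfl

@[simp]
theorem setStack_eq (S : Store) : setStack S = S.set := rfl

end Store

/-! ### Passes over an expression -/

namespace Prog

/-- Copy the tokens of the stack `body` to `aux`, with `g` executed at every variable. -/
def pass (g : Prog Stk) : Prog Stk :=
  loopTok .body fun a => if a = .var then g else pushTok .aux a skip

/-- Fix the first variable of the first block to `b`. -/
def substPass (b : Bool) : Prog Stk :=
  pass <| popTok .body fun a =>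
    if a = .bit false then
      popTok .body fun a' =>
        if a' = .bit false then pushTok .aux (.const b) skip
        else pushTok .aux .var (pushTok .aux a skip)
    else pushTok .aux .var (pushTok .aux a skip)

/-- Remove the exhausted first block. -/
def shiftPass : Prog Stk :=
  pass <| popTok .body fun a =>
    if a = .bit false then push .bad true skip else pushTok .aux .var skip

/-- Handle a token of an expression that is read backwards, `val` being the stack of the values of
its subexpressions. -/
def evalTok : Tok → Prog Stk
  | .bit _ => skip
  | .const c => push .val c skip
  | .var => push .bad true (push .val false skip)
  | .neg => pop .val fun x => push .val (!x.getD false) skip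
  | .and => pop .val fun x => pop .val fun y => push .val (x.getD false && y.getD false) skip
  | .or => pop .val fun x => pop .val fun y => push .val (x.getD false || y.getD false) skip

/-- Evaluate the expression with reversed tokens on `aux`, all variables being false. -/
def evalPass : Prog Stk := loopTok .aux evalTok

end Prog

section Passes

variable {φ : PromiseProblem} {S : Store} {u : ℕ} {Q : Store → Prop} {g : Prog Stk}
  {r A A' : List Tok} {l l' : List Bool}

theorem Runs.pass_nil (h : Q { S with body := [] }) :
    Runs .qry φ (.pass g) { S with body := [] } (u + 1) Q :=
  .loopTok_nil rfl h

theorem Runs.pass_cons {a : Tok} (ha : a ≠ .var)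
    (h : Runs .qry φ (.pass g) { S with body := enc r, aux := enc (a :: A) } u Q) :
    Runs .qry φ (.pass g) { S with body := enc (a :: r), aux := enc A } (u + 20) Q := by
  refine (Runs.loopTok_cons (a := a) (l := enc r) rfl (t := 4) (u := u)
    (R := (· = { S with body := enc r, aux := enc (a :: A) })) ?_ ?_).mono (by omega)
  · simp [ha, runs_pushTok_iff, runs_skip_iff, Store.set, Store.get, enc_cons]
  · rintro _ rfl
    exact h

theorem Runs.pass_bitToks
    (h : Runs .qry φ (.pass g)
      { S with body := enc r, aux := enc ((bitToks l).reverse ++ A) } u Q) :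
    Runs .qry φ (.pass g) { S with body := enc (bitToks l ++ r), aux := enc A }
      (u + 20 * l.length) Q := by
  induction l generalizing A with
  | nil => exact h
  | cons b l ih =>
    refine (Runs.pass_cons (by simp) (ih (A := .bit b :: A) ?_)).mono
      (by simp only [List.length_cons]; omega)
    simpa [bitToks] using h

theorem Runs.pass_var (S' : Store) (hl : l'.length ≤ l.length)
    (hg : Runs .qry φ g { S with body := enc (bitToks l ++ r), aux := enc A } 15
      (· = { S' with body := enc (bitToks l' ++ r), aux := enc A' }))
    (h : Runs .qry φ (.pass g)
      { S' with body := enc r, aux := enc ((bitToks l').reverse ++ A') } u Q) :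
    Runs .qry φ (.pass g) { S with body := enc (.var :: (bitToks l ++ r)), aux := enc A }
      (u + 20 * (Tok.var :: bitToks l).length) Q := by
  refine (Runs.loopTok_cons (a := .var) (l := enc (bitToks l ++ r)) rfl (t := 15)
    (u := u + 20 * l'.length) (by simpa [Store.set] using hg) ?_).mono
    (u := u + 20 * (Tok.var :: bitToks l).length)
    (by simp only [List.length_cons, bitToks, List.length_map]; omega)
  rintro _ rfl
  exact pass_bitToks h

theorem Runs.substPass_var (b : Bool) (i j : ℕ)
    (h : Runs .qry φ (.substPass b)
      { S with body := enc r, aux := enc (((XExpr.var i j).subst b).toks.reverse ++ A) } u Q) :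
    Runs .qry φ (.substPass b) { S with body := enc ((XExpr.var i j).toks ++ r), aux := enc A }
      (u + 20 * (XExpr.var i j).toks.length) Q := by
  rcases i with _ | i
  · rcases j with _ | j
    · refine pass_var (l := [false, false]) (l' := []) S (Nat.zero_le _) (A' := .const b :: A) ?_ h
      simp [bitToks, runs_popTok_iff (a := .bit false), runs_pushTok_iff, runs_skip_iff, Store.set,
        Store.get, enc_cons]
    · refine pass_var (l := false :: true :: unary j) (l' := unary j) S (by simp; omega)
        (A' := .bit false :: .var :: A) ?_ ?_
      · simp [bitToks, runs_popTok_iff (a := .bit false), runs_popTok_iff (a := .bit true),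
          runs_pushTok_iff, runs_skip_iff, Store.set, Store.get, enc_cons]
      · simpa [Prog.substPass, XExpr.subst, XExpr.toks, bitToks, unary] using h
  · refine pass_var (l := true :: (unary i ++ unary j)) (l' := unary i ++ unary j) S (by simp)
      (A' := .bit true :: .var :: A) ?_ ?_
    · simp [bitToks, runs_popTok_iff (a := .bit true), runs_pushTok_iff, runs_skip_iff, Store.set,
        Store.get, enc_cons]
    · simpa [Prog.substPass, XExpr.subst, XExpr.toks, bitToks, unary, List.replicate_succ] using h

theorem Runs.substPass (b : Bool) (f : XExpr)
    (h : Runs .qry φ (.substPass b)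
      { S with body := enc r, aux := enc ((f.subst b).toks.reverse ++ A) } u Q) :
    Runs .qry φ (.substPass b) { S with body := enc (f.toks ++ r), aux := enc A }
      (u + 20 * f.toks.length) Q := by
  induction f generalizing r A u with
  | const c => exact pass_cons (by simp) h
  | var i j => exact substPass_var b i j h
  | neg f ih =>
    refine (pass_cons (by simp) (ih (u := u) (A := .neg :: A) ?_)).mono
      (by simp only [XExpr.toks, List.length_cons]; omega)
    simpa [XExpr.subst, XExpr.toks] using h
  | and f g ihf ihg =>
    simp only [XExpr.toks, List.cons_append, List.append_assoc]
    refine (pass_cons (by simp) (ihf (A := .and :: A) (ihg (u := u) ?_))).mono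
      (by simp only [List.length_cons, List.length_append]; omega)
    simpa [XExpr.subst, XExpr.toks] using h
  | or f g ihf ihg =>
    simp only [XExpr.toks, List.cons_append, List.append_assoc]
    refine (pass_cons (by simp) (ihf (A := .or :: A) (ihg (u := u) ?_))).mono
      (by simp only [List.length_cons, List.length_append]; omega)
    simpa [XExpr.subst, XExpr.toks] using h

theorem Runs.shiftPass_var (i j : ℕ) {B : List Bool}
    (h : Runs .qry φ .shiftPass { S with
      body := enc r
      aux := enc ((XExpr.var i j).shiftToks.reverse ++ A)
      bad := (XExpr.var i j).shiftErrors ++ B } u Q) :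
    Runs .qry φ .shiftPass { S with
      body := enc ((XExpr.var i j).toks ++ r), aux := enc A, bad := B }
      (u + 20 * (XExpr.var i j).toks.length) Q := by
  rcases i with _ | i
  · refine pass_var (S := { S with bad := B }) (l := false :: unary j) (l' := unary j)
      { S with bad := true :: B } (by simp) (A' := A) ?_ h
    simp [bitToks, runs_popTok_iff (a := .bit false), runs_push_iff, runs_skip_iff, Store.set,
      Store.get, enc_cons]
  · refine pass_var (S := { S with bad := B }) (l := true :: (unary i ++ unary j))
      (l' := unary i ++ unary j) { S with bad := B } (by simp) (A' := .var :: A) ?_ ?_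
    · simp [bitToks, runs_popTok_iff (a := .bit true), runs_pushTok_iff, runs_skip_iff, Store.set,
        Store.get, enc_cons]
    · simpa [Prog.shiftPass, XExpr.shiftToks, XExpr.shiftErrors, XExpr.toks] using h

theorem Runs.shiftPass (f : XExpr) {B : List Bool}
    (h : Runs .qry φ .shiftPass { S with
      body := enc r, aux := enc (f.shiftToks.reverse ++ A), bad := f.shiftErrors ++ B } u Q) :
    Runs .qry φ .shiftPass { S with body := enc (f.toks ++ r), aux := enc A, bad := B }
      (u + 20 * f.toks.length) Q := by
  induction f generalizing r A B u with
  | const c => exact pass_cons (S := { S with bad := B }) (by simp) h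
  | var i j => exact shiftPass_var i j h
  | neg f ih =>
    refine (pass_cons (S := { S with bad := B }) (by simp) (ih (u := u) (A := .neg :: A) ?_)).mono
      (by simp only [XExpr.toks, List.length_cons]; omega)
    simpa [XExpr.shiftToks, XExpr.shiftErrors] using h
  | and f g ihf ihg =>
    simp only [XExpr.toks, List.cons_append, List.append_assoc]
    refine (pass_cons (S := { S with bad := B }) (by simp)
      (ihf (A := .and :: A) (ihg (u := u) ?_))).mono
      (by simp only [List.length_cons, List.length_append]; omega)
    simpa [XExpr.shiftToks, XExpr.shiftErrors] using h
  | or f g ihf ihg =>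
    simp only [XExpr.toks, List.cons_append, List.append_assoc]
    refine (pass_cons (S := { S with bad := B }) (by simp)
      (ihf (A := .or :: A) (ihg (u := u) ?_))).mono
      (by simp only [List.length_cons, List.length_append]; omega)
    simpa [XExpr.shiftToks, XExpr.shiftErrors] using h

theorem Runs.evalPass_cons {a : Tok} (S' : Store)
    (ha : Runs .qry φ (.evalTok a) { S with aux := enc r } 5 (· = S'))
    (h : Runs .qry φ .evalPass S' u Q) :
    Runs .qry φ .evalPass { S with aux := enc (a :: r) } (u + 20) Q := by
  refine (Runs.loopTok_cons (a := a) (l := enc r) rfl ha (u := u) ?_).mono (by omega)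
  rintro _ rfl
  exact h

theorem Runs.evalPass_bitToks (h : Runs .qry φ .evalPass { S with aux := enc r } u Q) :
    Runs .qry φ .evalPass { S with aux := enc ((bitToks l).reverse ++ r) }
      (u + 20 * l.length) Q := by
  induction l generalizing r u with
  | nil => exact h
  | cons b l ih =>
    have hb : Runs .qry φ .evalPass { S with aux := enc (.bit b :: r) } (u + 20) Q :=
      evalPass_cons { S with aux := enc r } (runs_skip_iff.2 rfl) h
    refine Runs.mono (t := u + 20 + 20 * l.length) ?_ (by simp only [List.length_cons]; omega)
    simpa [bitToks] using ih hb

theorem Runs.evalPass (f : XExpr) {B V : List Bool}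
    (h : Runs .qry φ .evalPass
      { S with aux := enc r, bad := f.varErrors ++ B, val := f.eval [] :: V } u Q) :
    Runs .qry φ .evalPass { S with aux := enc (f.toks.reverse ++ r), bad := B, val := V }
      (u + 20 * f.toks.length) Q := by
  induction f generalizing r B V u with
  | const c =>
    refine evalPass_cons (S := { S with bad := B, val := V }) _ ?_ h
    exact runs_push_iff.2 (runs_skip_iff.2 rfl)
  | var i j =>
    have hvar : Runs .qry φ .evalPass { S with aux := enc (.var :: r), bad := B, val := V }
        (u + 20) Q := by
      refine evalPass_cons (S := { S with bad := B, val := V }) _ ?_ h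
      exact runs_push_iff.2 (runs_push_iff.2 (runs_skip_iff.2 rfl))
    refine Runs.mono (t := u + 20 + 20 * (unary i ++ unary j).length) ?_
      (by simp only [XExpr.toks, List.length_cons, bitToks, List.length_map]; omega)
    simpa [XExpr.toks] using evalPass_bitToks (l := unary i ++ unary j)
      (S := { S with bad := B, val := V }) hvar
  | neg f ih =>
    refine Runs.mono (t := u + 20 + 20 * f.toks.length) ?_
      (by simp only [XExpr.toks, List.length_cons]; omega)
    rw [XExpr.toks, List.reverse_cons, List.append_assoc]
    refine ih (evalPass_cons (S := { S with bad := f.varErrors ++ B, val := _ }) _ ?_ h)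
    exact runs_pop_iff.2 (runs_push_iff.2 (runs_skip_iff.2 rfl))
  | and f g ihf ihg | or f g ihf ihg =>
    rw [XExpr.varErrors, List.append_assoc] at h
    refine Runs.mono (t := u + 20 + 20 * f.toks.length + 20 * g.toks.length) ?_
      (by simp only [XExpr.toks, List.length_cons, List.length_append]; omega)
    rw [XExpr.toks, List.reverse_cons, List.reverse_append, List.append_assoc, List.append_assoc]
    refine ihg (ihf (evalPass_cons
      (S := { S with bad := f.varErrors ++ (g.varErrors ++ B), val := _ }) _ ?_ h))
    exact runs_pop_iff.2 (runs_pop_iff.2 (runs_push_iff.2 (runs_skip_iff.2 rfl)))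

end Passes

/-! ### Parsing -/

namespace Prog

/-- The loop of `readUnary`, which runs as long as `grd` is not empty. -/
def readUnaryLoop (dst : Stk) (em : Bool → List Bool) : Prog Stk :=
  loop .grd fun _ => pop .inp fun
    | none => push .bad true skip
    | some b => pushList dst (em b) (pushList .grd (if b then [true] else []) skip)

/-- Read a unary number from the input and write its bits, encoded by `em`, on `dst`. -/
def readUnary (dst : Stk) (em : Bool → List Bool) : Prog Stk :=
  push .grd true (readUnaryLoop dst em)

/-- Read `k` positive block sizes from the input, their reversed encoding being left on `tmp`. -/
def parseHeader : ℕ → Prog Stk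
  | 0 => skip
  | k + 1 => pop .inp fun o =>
      if o = some true then
        push .tmp true <| seq (readUnary .tmp fun b => [b]) <| pop .bad fun
          | none => parseHeader k
          | some _ => push .bad true skip
      else push .bad true skip

/-- Read the two indices of a variable. -/
def readIndices : Prog Stk :=
  seq (readUnary .aux fun b => (Tok.bit b).code) (readUnary .aux fun b => (Tok.bit b).code)

/-- Handle the first two bits of an expression, a bit being pushed on `val` for every
subexpression to be read. -/
def parseNode : Bool → Bool → Prog Stk
  | false, false => pushTok .aux .neg (pushList .val [true] skip)
  | false, true => pushTok .aux .and (pushList .val [true, true] skip)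
  | true, false => pushTok .aux .or (pushList .val [true, true] skip)
  | true, true => pushTok .aux .var readIndices

/-- Read as many expressions as there are bits on `val`, their reversed tokens being left on
`aux`. -/
def parseExprs : Prog Stk :=
  loop .val fun _ => pop .inp fun
    | none => push .bad true skip
    | some a => pop .inp fun
      | none => push .bad true skip
      | some b => parseNode a b

end Prog

theorem length_unary (i : ℕ) : (unary i).length = i + 1 := by simp [unary]

theorem eq_unary_append_or_eq_replicate (l : List Bool) :
    (∃ i r, l = unary i ++ r) ∨ ∃ i, l = List.replicate i true := by
  induction l with
  | nil => exact .inr ⟨0, rfl⟩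
  | cons b l ih =>
    cases b with
    | false => exact .inl ⟨0, l, rfl⟩
    | true =>
      rcases ih with ⟨i, r, rfl⟩ | ⟨i, rfl⟩
      · exact .inl ⟨i + 1, r, rfl⟩
      · exact .inr ⟨i + 1, rfl⟩

theorem unary_append_ne_replicate (i j : ℕ) (r : List Bool) :
    unary i ++ r ≠ List.replicate j true := by
  intro h
  have : false ∈ List.replicate j true := h ▸ by simp [unary]
  simp at this

section ReadUnary

variable {φ : PromiseProblem} {S : Store} {u : ℕ} {Q : Store → Prop} {dst : Stk}
  {em : Bool → List Bool}

theorem Runs.readUnaryLoop_cons (hd : dst = .tmp ∨ dst = .aux) (hem : ∀ b, (em b).length ≤ 3)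
    (b : Bool) (r D : List Bool)
    (h : Runs .qry φ (.readUnaryLoop dst em)
      (({ S with inp := r, grd := if b then [true] else [] }).set dst (em b ++ D)) u Q) :
    Runs .qry φ (.readUnaryLoop dst em)
      (({ S with inp := b :: r, grd := [true] }).set dst D) (u + 10) Q := by
  refine Runs.mono (t := 1 + 1 + 3 + 1 + u + 1) ?_ (by omega)
  refine Runs.loop_cons (b := true) (l := []) (by rcases hd with rfl | rfl <;> rfl)
    (R := (· = ({ S with inp := r, grd := if b then [true] else [] }).set dst (em b ++ D))) ?_ ?_
  · rw [runs_pop_iff]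
    rcases hd with rfl | rfl <;>
    · refine (Runs.pushList (u := 1 + 1) ?_).mono (Nat.add_le_add_left (hem b) _)
      refine (Runs.pushList (u := 1) ?_).mono (by cases b <;> simp)
      cases b <;> exact runs_skip_iff.2 rfl
  · rintro _ rfl
    exact h

theorem Runs.readUnaryLoop (hd : dst = .tmp ∨ dst = .aux) (hem : ∀ b, (em b).length ≤ 3) (i : ℕ)
    (r D : List Bool) :
    Runs .qry φ (.readUnaryLoop dst em) (({ S with inp := unary i ++ r, grd := [true] }).set dst D)
      (10 * i + 15)
      (· = ({ S with inp := r, grd := [] }).set dst ((unary i).reverse.flatMap em ++ D)) := by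
  induction i generalizing D with
  | zero =>
    refine (readUnaryLoop_cons hd hem false r D (u := 1) ?_).mono (by omega)
    refine Runs.loop_nil (by rcases hd with rfl | rfl <;> rfl) ?_
    simp [unary]
  | succ i ih =>
    refine (readUnaryLoop_cons hd hem true (unary i ++ r) D (ih _)).mono (by omega) |>.imp ?_
    rintro _ rfl
    simp [unary, List.replicate_succ]

theorem Runs.readUnaryLoop_fail (hd : dst = .tmp ∨ dst = .aux) (hem : ∀ b, (em b).length ≤ 3)
    (i : ℕ) (D : List Bool) :
    Runs .qry φ (.readUnaryLoop dst em)
      (({ S with inp := List.replicate i true, grd := [true] }).set dst D) (10 * i + 15)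
      fun S' => ∃ D', S' = ({ S with inp := [], grd := [], bad := true :: S.bad }).set dst D' := by
  induction i generalizing D with
  | zero =>
    refine Runs.mono (t := 3 + (0 + 1) + 1) ?_ (by omega)
    refine Runs.loop_cons (t := 3) (u := 0 + 1) (b := true) (l := [])
      (by rcases hd with rfl | rfl <;> rfl)
      (R := (· = ({ S with inp := [], grd := [], bad := true :: S.bad }).set dst D)) ?_ ?_
    · rcases hd with rfl | rfl <;> exact runs_pop_iff.2 (runs_push_iff.2 (runs_skip_iff.2 rfl))
    · rintro _ rfl
      exact Runs.loop_nil (by rcases hd with rfl | rfl <;> rfl) ⟨D, rfl⟩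
  | succ i ih => exact (readUnaryLoop_cons hd hem true (.replicate i true) D (ih _)).mono (by omega)

end ReadUnary

/-- A list `l` begins with a header of `k` block sizes, which is followed by `r`. -/
def HeaderOf (k : ℕ) (l : List Bool) (sizes : List ℕ) (r : List Bool) : Prop :=
  sizes.length = k ∧ (∀ m ∈ sizes, 1 ≤ m) ∧ l = sizes.flatMap unary ++ r

theorem HeaderOf.exists_cons {k : ℕ} {l r : List Bool} {sizes : List ℕ}
    (h : HeaderOf (k + 1) l sizes r) : ∃ m l' sizes', sizes = (m + 1) :: sizes' ∧
      l = true :: (unary m ++ l') ∧ HeaderOf k l' sizes' r := by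
  obtain ⟨hl, h1, rfl⟩ := h
  rcases sizes with _ | ⟨_ | m, sizes⟩
  · simp at hl
  · simp at h1
  · refine ⟨m, sizes.flatMap unary ++ r, sizes, rfl, ?_, by simpa using hl,
      fun k hk => h1 k (List.mem_cons_of_mem _ hk), rfl⟩
    simp [unary, List.replicate_succ]

/-- The outcome of reading a header of `k` block sizes from `l`, with `D` on the stack `tmp`. -/
def HeaderOutcome (S : Store) (k : ℕ) (l D : List Bool) (S' : Store) : Prop :=
  (∃ sizes r, HeaderOf k l sizes r ∧
    S' = { S with inp := r, tmp := (sizes.flatMap unary).reverse ++ D }) ∨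
  ((¬ ∃ sizes r, HeaderOf k l sizes r) ∧ S'.bad ≠ [] ∧ S'.out = S.out)

theorem HeaderOutcome.cons {S S' : Store} {k i : ℕ} {l D : List Bool}
    (h : HeaderOutcome S k l ((unary (i + 1)).reverse ++ D) S') :
    HeaderOutcome S (k + 1) (true :: (unary i ++ l)) D S' := by
  rcases h with ⟨sizes, r, ⟨hl, h1, rfl⟩, rfl⟩ | ⟨hno, h⟩
  · refine .inl ⟨(i + 1) :: sizes, r, ⟨by simp [hl], by simpa using h1, ?_⟩, by simp⟩
    simp [unary, List.replicate_succ]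
  · refine .inr ⟨?_, h⟩
    rintro ⟨_, r, hs⟩
    obtain ⟨m, l', sizes, -, he, hs'⟩ := hs.exists_cons
    obtain ⟨-, rfl⟩ := unary_append_inj (List.cons.inj he).2
    exact hno ⟨sizes, r, hs'⟩

section ParseHeader

variable {φ : PromiseProblem} {S : Store} {k : ℕ} {l D : List Bool}

theorem Runs.parseHeader_of_head?_ne (hl : l.head? ≠ some true) :
    Runs .qry φ (.parseHeader (k + 1)) { S with inp := l, tmp := D } 3
      (HeaderOutcome S (k + 1) l D) := by
  refine runs_pop_iff.2 ?_
  simp only [Store.stack_eq, Store.get, hl, if_false]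
  refine runs_push_iff.2 (runs_skip_iff.2 (.inr ⟨?_, by simp [Store.set], rfl⟩))
  rintro ⟨_, r, h⟩
  obtain ⟨m, l', sizes, -, rfl, -⟩ := h.exists_cons
  exact hl rfl

theorem Runs.parseHeader_replicate (hgrd : S.grd = []) (i : ℕ) :
    Runs .qry φ (.parseHeader (k + 1)) { S with inp := true :: List.replicate i true, tmp := D }
      (10 * i + 25) (HeaderOutcome S (k + 1) (true :: List.replicate i true) D) := by
  refine Runs.mono (t := (10 * i + 15 + 1) + (2 + 1) + 1 + 1) ?_ (by omega)
  refine runs_pop_iff.2 (runs_push_iff.2 ?_)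
  refine Runs.seq (t := 10 * i + 15 + 1) (u := 2 + 1) (R := fun S' => ∃ D',
    S' = { S with inp := [], tmp := D', bad := true :: S.bad }) (runs_push_iff.2 ?_) ?_
  · have hrun := Runs.readUnaryLoop_fail (φ := φ) (S := S) (dst := .tmp) (em := fun b => [b])
      (.inl rfl) (by simp) i (true :: D)
    simpa [Store.set, Store.get, hgrd] using hrun
  · rintro _ ⟨D', rfl⟩
    refine runs_pop_iff.2 (runs_push_iff.2 (runs_skip_iff.2 (.inr ⟨?_, by simp [Store.set], rfl⟩)))
    rintro ⟨_, r, h⟩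
    obtain ⟨m, l', sizes, -, he, -⟩ := h.exists_cons
    exact unary_append_ne_replicate _ _ _ (List.cons.inj he).2.symm

theorem Runs.parseHeader_unary_append (hbad : S.bad = []) (hgrd : S.grd = []) (i : ℕ) {u : ℕ}
    (h : Runs .qry φ (.parseHeader k) { S with inp := l, tmp := (unary (i + 1)).reverse ++ D } u
      (HeaderOutcome S k l ((unary (i + 1)).reverse ++ D))) :
    Runs .qry φ (.parseHeader (k + 1)) { S with inp := true :: (unary i ++ l), tmp := D }
      (u + (10 * i + 20)) (HeaderOutcome S (k + 1) (true :: (unary i ++ l)) D) := by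
  refine Runs.mono (t := (10 * i + 15 + 1) + (u + 1) + 1 + 1) ?_ (by omega)
  refine runs_pop_iff.2 (runs_push_iff.2 ?_)
  refine Runs.seq_eq (s' := { S with inp := l, tmp := (unary (i + 1)).reverse ++ D })
    (runs_push_iff.2 ?_) (runs_pop_iff.2 ?_)
  · have hrun := Runs.readUnaryLoop (φ := φ) (S := S) (dst := .tmp) (em := fun b => [b])
      (.inl rfl) (by simp) i l (true :: D)
    simpa [Store.set, Store.get, hgrd, unary, List.replicate_succ] using hrun
  · simpa [Store.set, Store.get, hbad] using h.imp fun S' => HeaderOutcome.cons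

theorem Runs.parseHeader (hbad : S.bad = []) (hgrd : S.grd = []) :
    Runs .qry φ (.parseHeader k) { S with inp := l, tmp := D } (20 * l.length + 30 * k + 1)
      (HeaderOutcome S k l D) := by
  induction k generalizing l D with
  | zero => exact runs_skip_iff.2 (.inl ⟨[], l, ⟨rfl, by simp, rfl⟩, rfl⟩)
  | succ k ih =>
    by_cases hl : l.head? = some true
    · obtain ⟨l, rfl⟩ := List.head?_eq_some_iff.1 hl
      rcases eq_unary_append_or_eq_replicate l with ⟨i, r, rfl⟩ | ⟨i, rfl⟩
      · exact (parseHeader_unary_append hbad hgrd i ih).mono (by simp [length_unary]; omega)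
      · exact (parseHeader_replicate hgrd i).mono (by simp; omega)
    · exact (parseHeader_of_head?_ne hl).mono (by omega)

end ParseHeader

/-- A list `l` begins with the `c` expressions `es`, which are followed by `r`. -/
def ForestOf (c : ℕ) (l : List Bool) (es : List BoolExpr) (r : List Bool) : Prop :=
  es.length = c ∧ l = es.flatMap BoolExpr.encode ++ r

/-- The tokens of a list of expressions. -/
def forestToks (es : List BoolExpr) : List Tok := es.flatMap fun e => (XExpr.ofBool e).toks

theorem ForestOf.exists_cons {c : ℕ} {l r : List Bool} {es : List BoolExpr}
    (h : ForestOf (c + 1) l es r) :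
    ∃ e es', es = e :: es' ∧ es'.length = c ∧
      l = e.encode ++ (es'.flatMap BoolExpr.encode ++ r) := by
  obtain ⟨hl, rfl⟩ := h
  rcases es with _ | ⟨e, es⟩
  · simp at hl
  · exact ⟨e, es, rfl, by simpa using hl, by simp⟩

theorem ForestOf.exists_unary {c : ℕ} {l r : List Bool} {es : List BoolExpr}
    (h : ForestOf (c + 1) (true :: true :: l) es r) :
    ∃ i j r' es', l = unary i ++ (unary j ++ r') ∧ ForestOf c r' es' r := by
  obtain ⟨e, es, rfl, hl, he⟩ := h.exists_cons
  obtain ⟨i, j, rfl⟩ : ∃ i j, e = .var i j := by cases e <;> simp_all [BoolExpr.encode]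
  exact ⟨i, j, _, es, by simpa [BoolExpr.encode] using he, hl, rfl⟩

theorem ForestOf.two_le_length {c : ℕ} {l r : List Bool} {es : List BoolExpr}
    (h : ForestOf (c + 1) l es r) : 2 ≤ l.length := by
  obtain ⟨e, es, rfl, -, rfl⟩ := h.exists_cons
  cases e <;> simp [BoolExpr.encode]

/-- The outcome of reading `c` expressions from `l`, with the tokens `A` on the stack `aux`. -/
def ExprsOutcome (S : Store) (c : ℕ) (l : List Bool) (A : List Tok) (S' : Store) : Prop :=
  (∃ es r, ForestOf c l es r ∧
    S' = { S with inp := r, val := [], aux := enc ((forestToks es).reverse ++ A) }) ∨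
  ((¬ ∃ es r, ForestOf c l es r) ∧ S'.bad ≠ [] ∧ S'.out = S.out)

section ParseExprs

variable {φ : PromiseProblem} {S S' : Store} {c u : ℕ} {l r : List Bool} {A : List Tok}

theorem ExprsOutcome.neg (h : ExprsOutcome S (c + 1) l (.neg :: A) S') :
    ExprsOutcome S (c + 1) (false :: false :: l) A S' := by
  rcases h with ⟨es, r, hf, rfl⟩ | ⟨hno, h⟩
  · obtain ⟨e, es, rfl, hl, rfl⟩ := hf.exists_cons
    exact .inl ⟨.neg e :: es, r, ⟨by simp [hl], by simp [BoolExpr.encode]⟩,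
      by simp [forestToks, XExpr.ofBool, XExpr.toks]⟩
  · refine .inr ⟨?_, h⟩
    rintro ⟨es, r, hf⟩
    obtain ⟨e, es, rfl, hl, he⟩ := hf.exists_cons
    obtain ⟨e, rfl⟩ : ∃ e', e = .neg e' := by cases e <;> simp_all [BoolExpr.encode]
    exact hno ⟨e :: es, r, by simp [hl], by simpa [BoolExpr.encode] using he⟩

theorem ExprsOutcome.and (h : ExprsOutcome S (c + 2) l (.and :: A) S') :
    ExprsOutcome S (c + 1) (false :: true :: l) A S' := by
  rcases h with ⟨es, r, hf, rfl⟩ | ⟨hno, h⟩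
  · obtain ⟨e, es, rfl, hl, rfl⟩ := hf.exists_cons
    rcases es with _ | ⟨e', es⟩
    · simp at hl
    exact .inl ⟨.and e e' :: es, r, ⟨by simpa using hl, by simp [BoolExpr.encode]⟩,
      by simp [forestToks, XExpr.ofBool, XExpr.toks]⟩
  · refine .inr ⟨?_, h⟩
    rintro ⟨es, r, hf⟩
    obtain ⟨e, es, rfl, hl, he⟩ := hf.exists_cons
    obtain ⟨e, e', rfl⟩ : ∃ e₁ e₂, e = .and e₁ e₂ := by cases e <;> simp_all [BoolExpr.encode]
    exact hno ⟨e :: e' :: es, r, by simp [hl], by simpa [BoolExpr.encode] using he⟩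

theorem ExprsOutcome.or (h : ExprsOutcome S (c + 2) l (.or :: A) S') :
    ExprsOutcome S (c + 1) (true :: false :: l) A S' := by
  rcases h with ⟨es, r, hf, rfl⟩ | ⟨hno, h⟩
  · obtain ⟨e, es, rfl, hl, rfl⟩ := hf.exists_cons
    rcases es with _ | ⟨e', es⟩
    · simp at hl
    exact .inl ⟨.or e e' :: es, r, ⟨by simpa using hl, by simp [BoolExpr.encode]⟩,
      by simp [forestToks, XExpr.ofBool, XExpr.toks]⟩
  · refine .inr ⟨?_, h⟩
    rintro ⟨es, r, hf⟩
    obtain ⟨e, es, rfl, hl, he⟩ := hf.exists_cons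
    obtain ⟨e, e', rfl⟩ : ∃ e₁ e₂, e = .or e₁ e₂ := by cases e <;> simp_all [BoolExpr.encode]
    exact hno ⟨e :: e' :: es, r, by simp [hl], by simpa [BoolExpr.encode] using he⟩

theorem ExprsOutcome.var {i j : ℕ} (h : ExprsOutcome S c l ((bitToks (unary j)).reverse ++
      ((bitToks (unary i)).reverse ++ .var :: A)) S') :
    ExprsOutcome S (c + 1) (true :: true :: (unary i ++ (unary j ++ l))) A S' := by
  rcases h with ⟨es, r, ⟨hl, rfl⟩, rfl⟩ | ⟨hno, h⟩
  · exact .inl ⟨.var i j :: es, r, ⟨by simp [hl], by simp [BoolExpr.encode]⟩,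
      by simp [forestToks, XExpr.ofBool, XExpr.toks, bitToks]⟩
  · refine .inr ⟨?_, h⟩
    rintro ⟨es, r, hf⟩
    obtain ⟨i', j', r', es', he, hf'⟩ := hf.exists_unary
    obtain ⟨-, he⟩ := unary_append_inj he
    obtain ⟨-, rfl⟩ := unary_append_inj he
    exact hno ⟨es', r, hf'⟩

theorem Runs.readUnary_aux (hgrd : S.grd = []) (i : ℕ) (r : List Bool) (A : List Tok) :
    Runs .qry φ (.readUnary .aux fun b => (Tok.bit b).code)
      { S with inp := unary i ++ r, aux := enc A } (10 * i + 16)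
      (· = { S with inp := r, aux := enc ((bitToks (unary i)).reverse ++ A) }) := by
  have hrun := Runs.readUnaryLoop (φ := φ) (S := S) (dst := .aux)
    (em := fun b => (Tok.bit b).code) (.inr rfl) (by simp [Tok.code]) i r (enc A)
  have henc : (unary i).reverse.flatMap (fun b => (Tok.bit b).code) =
      enc (bitToks (unary i)).reverse := by
    rw [bitToks, ← List.map_reverse, enc, List.flatMap_map]
  rw [henc, ← enc_append] at hrun
  exact runs_push_iff.2 (by simpa [Store.set, Store.get, hgrd] using hrun)

theorem Runs.readUnary_aux_fail (hgrd : S.grd = []) (i : ℕ) (D : List Bool) :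
    Runs .qry φ (.readUnary .aux fun b => (Tok.bit b).code)
      { S with inp := List.replicate i true, aux := D } (10 * i + 16)
      fun S' => ∃ D', S' = { S with inp := [], aux := D', bad := true :: S.bad } := by
  have hrun := Runs.readUnaryLoop_fail (φ := φ) (S := S) (dst := .aux)
    (em := fun b => (Tok.bit b).code) (.inr rfl) (by simp [Tok.code]) i D
  exact runs_push_iff.2 (by simpa [Store.set, Store.get, hgrd] using hrun)

theorem Runs.readIndices (hgrd : S.grd = []) (i j : ℕ) (r : List Bool) (A : List Tok) :
    Runs .qry φ .readIndices { S with inp := unary i ++ (unary j ++ r), aux := enc A }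
      (10 * (i + j) + 32) (· = { S with
        inp := r
        aux := enc ((bitToks (unary j)).reverse ++ ((bitToks (unary i)).reverse ++ A)) }) :=
  (seq_eq (readUnary_aux hgrd i _ A) (readUnary_aux hgrd j r _)).mono (by omega)

theorem Runs.readIndices_fail (hgrd : S.grd = []) (hl : ¬ ∃ i j r, l = unary i ++ (unary j ++ r)) :
    Runs .qry φ .readIndices { S with inp := l, aux := enc A } (10 * l.length + 32)
      fun S' => ∃ D B, B ≠ [] ∧ S' = { S with inp := [], aux := D, bad := B } := by
  rcases eq_unary_append_or_eq_replicate l with ⟨i, l, rfl⟩ | ⟨i, rfl⟩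
  · rcases eq_unary_append_or_eq_replicate l with ⟨j, r, rfl⟩ | ⟨j, rfl⟩
    · exact absurd ⟨i, j, r, rfl⟩ hl
    · refine ((seq_eq (readUnary_aux hgrd i _ A) (readUnary_aux_fail hgrd j _)).mono
        (by simp [length_unary]; omega)).imp ?_
      rintro _ ⟨D, rfl⟩
      exact ⟨D, _, List.cons_ne_nil _ _, rfl⟩
  · refine Runs.mono (t := (10 * i + 16) + (10 * 0 + 16))
      (seq (readUnary_aux_fail hgrd i _) ?_) (by simp)
    rintro _ ⟨D, rfl⟩
    refine (readUnary_aux_fail (S := { S with bad := true :: S.bad }) hgrd 0 D).imp ?_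
    rintro _ ⟨D', rfl⟩
    exact ⟨D', _, List.cons_ne_nil _ _, rfl⟩

theorem Runs.parseExprs_nil (c : ℕ) (B : List Bool) :
    Runs .qry φ .parseExprs { S with inp := [], val := List.replicate c true, bad := B } (5 * c + 1)
      fun S' => (B ≠ [] ∨ c ≠ 0 → S'.bad ≠ []) ∧ S'.out = S.out := by
  induction c generalizing B with
  | zero => exact .loop_nil rfl (by simp)
  | succ c ih =>
    refine Runs.mono (t := 3 + (5 * c + 1) + 1) ?_ (by omega)
    refine .loop_cons (b := true) (l := List.replicate c true) rfl
      (R := (· = { S with inp := [], val := List.replicate c true, bad := true :: B })) ?_ ?_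
    · exact runs_pop_iff.2 (runs_push_iff.2 (runs_skip_iff.2 rfl))
    · rintro _ rfl
      exact (ih (true :: B)).imp fun S' h => ⟨fun _ => h.1 (.inl (List.cons_ne_nil _ _)), h.2⟩

theorem Runs.parseExprs_fail {c' : ℕ} {B D : List Bool} (hB : B ≠ [] ∨ c' ≠ 0)
    (hno : ¬ ∃ es r, ForestOf c l es r) :
    Runs .qry φ .parseExprs { S with inp := [], val := List.replicate c' true, aux := D, bad := B }
      (5 * c' + 1) (ExprsOutcome S c l A) :=
  (parseExprs_nil (S := { S with aux := D }) c' B).imp fun _ h => .inr ⟨hno, h.1 hB, h.2⟩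

theorem Runs.parseExprs_of_length_lt_two (hl : l.length < 2) :
    Runs .qry φ .parseExprs { S with inp := l, val := List.replicate (c + 1) true, aux := enc A }
      (5 * c + 10) (ExprsOutcome S (c + 1) l A) := by
  have hno : ¬ ∃ es r, ForestOf (c + 1) l es r := fun ⟨_, _, hf⟩ => hl.not_ge hf.two_le_length
  rcases l with _ | ⟨a, _ | ⟨b, l⟩⟩
  · exact (parseExprs_fail (.inr c.succ_ne_zero) hno).mono (by omega)
  · refine Runs.mono (t := 4 + (5 * c + 1) + 1) ?_ (by omega)
    refine .loop_cons (b := true) (l := List.replicate c true) rfl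
      (R := (· = { S with
        inp := [], val := List.replicate c true, aux := enc A, bad := true :: S.bad })) ?_ ?_
    · exact runs_pop_iff.2 (runs_pop_iff.2 (runs_push_iff.2 (runs_skip_iff.2 rfl)))
    · rintro _ rfl
      exact parseExprs_fail (.inl (List.cons_ne_nil _ _)) hno
  · simp only [List.length_cons] at hl
    omega

theorem Runs.parseExprs_cons_cons {a b : Bool} {t : ℕ} {Q R : Store → Prop}
    (h : Runs .qry φ (.parseNode a b) { S with inp := l, val := List.replicate c true } t R)
    (h' : ∀ S', R S' → Runs .qry φ .parseExprs S' u Q) :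
    Runs .qry φ .parseExprs { S with inp := a :: b :: l, val := List.replicate (c + 1) true }
      (u + t + 3) Q := by
  refine (loop_cons (b := true) (l := List.replicate c true) rfl
    (runs_pop_iff.2 (runs_pop_iff.2 ?_)) h').mono (t := t + 1 + 1 + u + 1) (by omega)
  exact h

theorem Runs.parseExprs_op {a b : Bool} {o : Tok} {v : List Bool} {Q : Store → Prop}
    (hab : Prog.parseNode a b = .pushTok .aux o (.pushList .val v .skip)) (hv : v.length ≤ 2)
    (h : Runs .qry φ .parseExprs
      { S with inp := l, val := v ++ List.replicate c true, aux := enc (o :: A) } u Q) :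
    Runs .qry φ .parseExprs
      { S with inp := a :: b :: l, val := List.replicate (c + 1) true, aux := enc A }
      (u + 20) Q := by
  refine (parseExprs_cons_cons (S := { S with aux := enc A }) (t := 1 + 2 + 3) (u := u)
    (R := (· = { S with inp := l, val := v ++ List.replicate c true, aux := enc (o :: A) }))
    ?_ ?_).mono (by omega)
  · rw [hab, runs_pushTok_iff]
    refine Runs.mono (t := 0 + 1 + v.length) (pushList (runs_skip_iff.2 ?_)) (by omega)
    rfl
  · rintro _ rfl
    exact h

theorem Runs.parseExprs_var (hgrd : S.grd = [])
    (ih : ∀ (l' : List Bool) (A' : List Tok), l'.length ≤ l.length → Runs .qry φ .parseExprs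
      { S with inp := l', val := List.replicate c true, aux := enc A' }
      (100 * l'.length + 10 * c + 1) (ExprsOutcome S c l' A')) :
    Runs .qry φ .parseExprs
      { S with inp := true :: true :: l, val := List.replicate (c + 1) true, aux := enc A }
      (100 * (l.length + 2) + 10 * (c + 1) + 1)
      (ExprsOutcome S (c + 1) (true :: true :: l) A) := by
  by_cases hl : ∃ i j r, l = unary i ++ (unary j ++ r)
  · obtain ⟨i, j, r, rfl⟩ := hl
    refine (parseExprs_cons_cons (S := { S with aux := enc A }) (runs_pushTok_iff.2
      (readIndices (S := { S with val := List.replicate c true }) hgrd i j r (.var :: A)))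
      (u := 100 * r.length + 10 * c + 1) ?_).mono
      (by simp only [List.length_append, length_unary]; omega)
    rintro _ rfl
    exact (ih r _ (by simp only [List.length_append]; omega)).imp fun S' => .var
  · refine (parseExprs_cons_cons (S := { S with aux := enc A }) (runs_pushTok_iff.2
      (readIndices_fail (S := { S with val := List.replicate c true }) (A := .var :: A) hgrd hl))
      (u := 5 * c + 1) ?_).mono (by omega)
    rintro _ ⟨D, B, hB, rfl⟩
    refine parseExprs_fail (.inl hB) ?_
    rintro ⟨es, r, hf⟩
    obtain ⟨i, j, r', es', he, -⟩ := hf.exists_unary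
    exact hl ⟨i, j, r', he⟩

theorem Runs.parseExprs (hgrd : S.grd = []) :
    Runs .qry φ .parseExprs { S with inp := l, val := List.replicate c true, aux := enc A }
      (100 * l.length + 10 * c + 1) (ExprsOutcome S c l A) := by
  induction hn : l.length using Nat.strong_induction_on generalizing c l A with
  | _ n ih =>
  subst hn
  rcases c with _ | c
  · exact .loop_nil rfl (.inl ⟨[], l, ⟨rfl, rfl⟩, rfl⟩)
  rcases lt_or_ge l.length 2 with hl | hl
  · exact (parseExprs_of_length_lt_two hl).mono (by omega)
  obtain ⟨a, b, l, rfl⟩ : ∃ a b l', l = a :: b :: l' := by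
    rcases l with _ | ⟨a, _ | ⟨b, l⟩⟩
    exacts [absurd hl (by simp), absurd hl (by simp), ⟨a, b, l, rfl⟩]
  have hrec {c' : ℕ} {A' : List Tok} := ih l.length (by simp) (l := l) (c := c') (A := A') rfl
  simp only [List.length_cons]
  rcases a <;> rcases b
  · exact ((parseExprs_op (v := [true]) rfl (by simp) (hrec (c' := c + 1))).mono (by omega)).imp
      fun S' => .neg
  · exact ((parseExprs_op (v := [true, true]) rfl le_rfl (hrec (c' := c + 2))).mono
      (by omega)).imp fun S' => .and
  · exact ((parseExprs_op (v := [true, true]) rfl le_rfl (hrec (c' := c + 2))).mono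
      (by omega)).imp fun S' => .or
  · exact parseExprs_var hgrd fun l' A' hl' =>
      ih l'.length (by simp only [List.length_cons]; omega) rfl

end ParseExprs

/-! ### Playing the game with an oracle for `VALₙ` -/

/-- The encoding of `d` blocks of size one. A query for a game with fewer than `n` blocks is padded
with them. -/
def padding (d : ℕ) : List Bool := (List.replicate d 1).flatMap unary

theorem length_padding (d : ℕ) : (padding d).length = 2 * d := by
  simp [padding, length_unary, Nat.mul_comm]

namespace Prog

/-- Write the expression with reversed tokens on `aux` on top of the query, restoring `body`. -/
def emitBody : Prog Stk := loopTok .aux fun a => pushTok .body a (pushList .qry a.bits skip)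

/-- Write the reversed block sizes on `tmp` on top of the query, restoring `hdr`. -/
def emitHdr : Prog Stk := loop .tmp fun b => push .hdr b (push .qry b skip)

/-- Write the query for the current expression and block sizes with `d` additional blocks. -/
def buildQuery (d : ℕ) : Prog Stk :=
  seq (moveTok .body .aux) <| seq emitBody <| pushList .qry (padding d) <|
    seq (move .hdr .tmp) emitHdr

/-- Fix the first variable of the first block to a value given by the oracle. The first letter of
the block size has been removed from `hdr`, so it is restored in the query only. -/
def round (d : ℕ) : Prog Stk :=
  seq (buildQuery d) <| push .qry true <| ask fun b =>
    seq (substPass b) <| seq (moveTok .aux .body) <| push .rnd true skip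

/-- Fix all variables of the first block to optimal values. -/
def rounds (d : ℕ) : Prog Stk :=
  loop .rnd fun _ => pop .hdr fun o => if o = some true then round d else skip

/-- Remove the exhausted first block and let `p` play the negated game for the opponent. -/
def switch (p : Prog Stk) : Prog Stk :=
  seq shiftPass <| seq (moveTok .aux .body) <| pop .bad fun
    | some _ => push .bad true skip
    | none => pushTok .body .neg <| seq p <| pop .val fun o => push .val (!o.getD false) skip

/-- Determine who wins the game with `k` blocks, `d` being the number of blocks of the oracle that
are not needed. -/
def game : ℕ → ℕ → Prog Stk
  | _, 0 => seq (moveTok .body .aux) evalPass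
  | d, k + 1 => push .rnd true <| seq (rounds d) <| switch (game (d + 1) k)

end Prog

section Game

variable {φ : PromiseProblem} {S : Store} {f : XExpr} {m : ℕ} {ms : List ℕ}

theorem Tok.length_bits_le (a : Tok) : a.bits.length ≤ 12 := by
  rcases a with _ | _ | _ | _ | (_ | _) | _ <;>
    simp [Tok.bits, XExpr.toBool, BoolExpr.encode, unary]

theorem Runs.emitBody (ts B : List Tok) (q : List Bool) :
    Runs .qry φ .emitBody { S with aux := enc ts, body := enc B, qry := q } (19 * ts.length + 1)
      (· = { S with
        aux := [], body := enc (ts.reverse ++ B), qry := ts.reverse.flatMap Tok.bits ++ q }) := by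
  induction ts generalizing B q with
  | nil => exact .loopTok_nil rfl rfl
  | cons a ts ih =>
    refine Runs.mono (t := (19 * ts.length + 1) + ((0 + 1 + a.bits.length + 3) + 3)) ?_
      (by have := a.length_bits_le; simp only [List.length_cons]; omega)
    refine .loopTok_cons (a := a) (l := enc ts) rfl
      (R := (· = { S with aux := enc ts, body := enc (a :: B), qry := a.bits ++ q })) ?_ ?_
    · exact runs_pushTok_iff.2 (.pushList (runs_skip_iff.2 rfl))
    · rintro _ rfl
      refine (ih (a :: B) (a.bits ++ q)).imp ?_
      rintro _ rfl
      simp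

theorem Runs.emitHdr (h H q : List Bool) :
    Runs .qry φ .emitHdr { S with tmp := h, hdr := H, qry := q } (4 * h.length + 1)
      (· = { S with tmp := [], hdr := h.reverse ++ H, qry := h.reverse ++ q }) := by
  induction h generalizing H q with
  | nil => exact .loop_nil rfl rfl
  | cons b h ih =>
    refine Runs.mono (t := (0 + 1 + 1 + 1) + (4 * h.length + 1) + 1) ?_
      (by simp only [List.length_cons]; omega)
    refine .loop_cons (b := b) (l := h) rfl
      (R := (· = { S with tmp := h, hdr := b :: H, qry := b :: q })) ?_ ?_
    · exact runs_push_iff.2 (runs_push_iff.2 (runs_skip_iff.2 rfl))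
    · rintro _ rfl
      refine (ih (b :: H) (b :: q)).imp ?_
      rintro _ rfl
      simp

theorem Runs.buildQuery (d : ℕ) (H : List Bool) (ts : List Tok) :
    Runs .qry φ (.buildQuery d)
      { S with hdr := H, body := enc ts, aux := [], tmp := [], qry := [] }
      (26 * ts.length + 2 * d + 7 * H.length + 4)
      (· = { S with
        hdr := H, body := enc ts, aux := [], tmp := []
        qry := H ++ (padding d ++ ts.flatMap Tok.bits) }) := by
  refine Runs.mono (t := (7 * ts.length + 1) + ((19 * ts.reverse.length + 1) +
    (((3 * H.length + 1) + (4 * H.reverse.length + 1)) + (padding d).length))) ?_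
    (by simp only [List.length_reverse, length_padding]; omega)
  refine Runs.seq_eq (.moveTok (by decide) ts [] rfl rfl) ?_
  have hbody := Runs.emitBody (φ := φ) (S := { S with hdr := H, tmp := [] }) ts.reverse [] []
  refine Runs.seq_eq (s' := { S with
    hdr := H, body := enc ts, aux := [], tmp := [], qry := ts.flatMap Tok.bits }) ?_ ?_
  · simpa [Store.set, enc_nil] using hbody
  refine .pushList (Runs.seq_eq (.move (by decide) H.length le_rfl) ?_)
  have hhdr := Runs.emitHdr (φ := φ) (S := { S with body := enc ts, aux := [] }) H.reverse []
    (padding d ++ ts.flatMap Tok.bits)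
  simpa [Store.set, Store.get] using hhdr

theorem Runs.substPass_of_aux_eq_nil (b : Bool) :
    Runs .qry φ (.substPass b) { S with body := enc f.toks, aux := [] } (1 + 20 * f.toks.length)
      (· = { S with body := [], aux := enc (f.subst b).toks.reverse }) := by
  have hrun := Runs.substPass (φ := φ) (S := S) (r := []) (A := []) (u := 0 + 1)
    (Q := (· = { S with body := [], aux := enc (f.subst b).toks.reverse })) b f
    (.pass_nil (S := { S with aux := enc ((f.subst b).toks.reverse ++ []) }) (by simp))
  simpa [enc_nil] using hrun

theorem Runs.shiftPass_of_aux_eq_nil :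
    Runs .qry φ .shiftPass { S with body := enc f.toks, aux := [], bad := [] }
      (1 + 20 * f.toks.length)
      (· = { S with body := [], aux := enc f.shiftToks.reverse, bad := f.shiftErrors }) := by
  have hrun := Runs.shiftPass (φ := φ) (S := S) (r := []) (A := []) (B := []) (u := 0 + 1)
    (Q := (· = { S with
      body := [], aux := enc f.shiftToks.reverse, bad := f.shiftErrors })) f
    (.pass_nil (S := { S with
      aux := enc (f.shiftToks.reverse ++ []), bad := f.shiftErrors ++ [] }) (by simp))
  simpa [enc_nil] using hrun

theorem Runs.round {d : ℕ} (hms : ∀ k ∈ ms, 1 ≤ k) {H : List Bool}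
    (hH : H = unary m ++ ms.flatMap unary) :
    Runs .qry (VAL (ms.length + 1 + d)) (.round d)
      { S with hdr := H, body := enc f.toks, aux := [], tmp := [], qry := [], rnd := [] }
      (60 * f.toks.length + 2 * d + 7 * H.length + 10)
      (fun S' => ∃ b, (f.WF ((m + 1) :: ms) →
          (Sat ((m + 1) :: ms) f.eval ↔ Sat (m :: ms) (f.subst b).eval)) ∧
        S' = { S with
          hdr := H, body := enc (f.subst b).toks, aux := [], tmp := [], qry := []
          rnd := [true] }) := by
  refine Runs.mono (t := (26 * f.toks.length + 2 * d + 7 * H.length + 4) +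
    (((1 + 20 * f.toks.length) + ((7 * f.toks.length + 1) + (0 + 1 + 1))) + 1 + 1)) ?_ (by omega)
  refine Runs.seq_eq (Runs.buildQuery (S := { S with rnd := [] }) d H f.toks) (runs_push_iff.2 ?_)
  refine .ask ⟨true :: (H ++ (padding d ++ f.toks.flatMap Tok.bits)), by simp⟩ rfl fun b hb => ?_
  refine Runs.seq_eq
    (Runs.substPass_of_aux_eq_nil (S := { S with hdr := H, tmp := [], qry := [], rnd := [] }) b) ?_
  refine Runs.seq_eq ((Runs.moveTok (by decide) (f.subst b).toks.reverse [] rfl rfl).mono ?_) ?_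
  · have := f.length_toks_subst_le b
    rw [List.length_reverse]
    omega
  · refine runs_push_iff.2 (runs_skip_iff.2 ⟨b, fun hf => ?_, ?_⟩)
    · refine XExpr.sat_cons_iff_subst_of_mem_VAL hf hms ?_ hb
      simp [hH, padding, unary, List.replicate_succ]
    · simp [Store.set, Store.get]

theorem Runs.rounds {d N : ℕ} (hms : ∀ k ∈ ms, 1 ≤ k)
    (hN : f.toks.length + (m + (ms.flatMap unary).length) + d ≤ N) :
    Runs .qry (VAL (ms.length + 1 + d)) (.rounds d)
      { S with
        hdr := unary m ++ ms.flatMap unary, body := enc f.toks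
        aux := [], tmp := [], qry := [], rnd := [true] }
      ((m + 1) * (100 * (N + 1)))
      fun S' => ∃ f' : XExpr, f'.toks.length ≤ f.toks.length ∧
        (f'.WF (0 :: ms) ↔ f.WF (m :: ms)) ∧
        (f.WF (m :: ms) → (Sat (m :: ms) f.eval ↔ Sat (0 :: ms) f'.eval)) ∧
        S' = { S with
          hdr := ms.flatMap unary, body := enc f'.toks, aux := [], tmp := [], qry := []
          rnd := [] } := by
  induction m generalizing f with
  | zero =>
    refine Runs.mono (t := (0 + 1 + 1) + (0 + 1) + 1) ?_ (by omega)
    refine .loop_cons (t := 0 + 1 + 1) (u := 0 + 1) (b := true) (l := []) rfl (R := (· = { S with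
      hdr := ms.flatMap unary, body := enc f.toks, aux := [], tmp := [], qry := []
      rnd := [] })) ?_ ?_
    · exact runs_pop_iff.2 (runs_skip_iff.2 rfl)
    · rintro _ rfl
      exact .loop_nil rfl ⟨f, le_rfl, Iff.rfl, fun _ => Iff.rfl, rfl⟩
  | succ m ih =>
    set H := unary m ++ ms.flatMap unary with hH
    have hHlen : H.length = m + 1 + (ms.flatMap unary).length := by
      rw [hH, List.length_append, length_unary]
    refine Runs.mono (t := (60 * f.toks.length + 2 * d + 7 * H.length + 10 + 1) +
      (m + 1) * (100 * (N + 1)) + 1) ?_ (by rw [Nat.succ_mul (m + 1)]; omega)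
    refine Runs.loop_cons (b := true) (l := []) rfl
      (runs_pop_iff.2 (Runs.round (S := S) (f := f) hms hH)) ?_
    rintro _ ⟨b, hb, rfl⟩
    have hlen := f.length_toks_subst_le b
    have hwf := XExpr.wf_subst b f m ms
    refine (ih (f := f.subst b) (by omega)).imp ?_
    rintro S' ⟨f', hlen', hwf', hsat, rfl⟩
    exact ⟨f', hlen'.trans hlen, hwf'.trans hwf, fun h => (hb h).trans (hsat (hwf.2 h)), rfl⟩

/-- The outcome `S'` of the game for `f` with blocks of sizes `ms`, played from `S`: the winner on
`val`, or an error on `bad` if `f` has a variable outside these blocks. -/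
def GameOutcome (S : Store) (ms : List ℕ) (f : XExpr) (S' : Store) : Prop :=
  S'.out = S.out ∧
    (f.WF ms → S'.bad = [] ∧ ∃ c, S'.val = [c] ∧ (c = true ↔ Sat ms f.eval)) ∧
    (¬ f.WF ms → S'.bad ≠ [])

theorem GameOutcome.congr {ms' : List ℕ} {f' : XExpr} {S' : Store} (h : GameOutcome S ms' f' S')
    (hwf : f'.WF ms' ↔ f.WF ms) (hsat : f.WF ms → (Sat ms f.eval ↔ Sat ms' f'.eval)) :
    GameOutcome S ms f S' := by
  refine ⟨h.1, fun hf => ?_, fun hf => h.2.2 (mt hwf.1 hf)⟩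
  obtain ⟨hbad, c, hval, hc⟩ := h.2.1 (hwf.2 hf)
  exact ⟨hbad, c, hval, hc.trans (hsat hf).symm⟩

theorem GameOutcome.of_neg_shift {S' : Store} (hf : f.shiftErrors = [])
    (h : GameOutcome S ms (.neg f.shift) S') :
    GameOutcome S (0 :: ms) f { S' with val := (!S'.val.head?.getD false) :: S'.val.tail } := by
  have hwf : f.WF (0 :: ms) ↔ (XExpr.neg f.shift).WF ms := by simp [f.wf_zero_cons, hf, XExpr.WF]
  refine ⟨h.1, fun hE => ?_, fun hE => h.2.2 (mt hwf.2 hE)⟩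
  obtain ⟨hbad, c, hval, hc⟩ := h.2.1 (hwf.1 hE)
  exact ⟨hbad, !c, by simp [hval], by rw [sat_zero_cons, ← hc, Bool.not_eq_true', Bool.not_eq_true]⟩

theorem Runs.switch {p : Prog Stk} {u : ℕ}
    (h : f.shiftErrors = [] → Runs .qry φ p
      { S with
        hdr := ms.flatMap unary, body := enc (XExpr.neg f.shift).toks
        aux := [], tmp := [], qry := [], rnd := [], bad := [], val := [] }
      u (GameOutcome S ms (.neg f.shift))) :
    Runs .qry φ (.switch p)
      { S with
        hdr := ms.flatMap unary, body := enc f.toks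
        aux := [], tmp := [], qry := [], rnd := [], bad := [], val := [] }
      (u + 27 * f.toks.length + 9) (GameOutcome S (0 :: ms) f) := by
  refine Runs.mono (t := (1 + 20 * f.toks.length) +
    ((7 * f.toks.length + 1) + ((u + (0 + 1 + 1 + 1)) + 3 + 1))) ?_ (by omega)
  refine Runs.seq_eq (Runs.shiftPass_of_aux_eq_nil (S := { S with
    hdr := ms.flatMap unary, tmp := [], qry := [], rnd := [], val := [] })) ?_
  refine Runs.seq_eq ((Runs.moveTok (by decide) f.shiftToks.reverse [] rfl rfl).mono
    (by have := f.length_shiftToks_le; rw [List.length_reverse]; omega)) (runs_pop_iff.2 ?_)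
  rcases hs : f.shiftErrors with _ | ⟨b, B⟩
  · refine runs_pushTok_iff.2 (Runs.seq (R := GameOutcome S ms (.neg f.shift)) ?_ fun S' hS' => ?_)
    · simpa [Store.set, Store.get, XExpr.toks, f.shiftToks_eq hs, enc_cons] using h hs
    · exact runs_pop_iff.2 (runs_push_iff.2 (runs_skip_iff.2 (hS'.of_neg_shift hs)))
  · refine Runs.mono (t := 0 + 1 + 1) (u := u + (0 + 1 + 1 + 1) + 3)
      (runs_push_iff.2 (runs_skip_iff.2 ⟨rfl, fun hf => ?_, ?_⟩)) (by omega)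
    · have := ((f.wf_zero_cons ms).1 hf).1
      simp [hs] at this
    · exact fun _ => List.cons_ne_nil _ _

theorem Runs.game_zero (d : ℕ) :
    Runs .qry φ (.game d 0)
      { S with
        hdr := [], body := enc f.toks
        aux := [], tmp := [], qry := [], rnd := [], bad := [], val := [] }
      (27 * f.toks.length + 2) (GameOutcome S [] f) := by
  refine Runs.mono (t := (7 * f.toks.length + 1) + (0 + 1 + 20 * f.toks.length)) ?_ (by omega)
  refine Runs.seq_eq (.moveTok (by decide) f.toks [] rfl rfl) ?_
  have hrun := Runs.evalPass (φ := φ) (u := 0 + 1) (r := []) (B := []) (V := [])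
    (S := { S with hdr := [], body := [], tmp := [], qry := [], rnd := [] })
    (Q := GameOutcome S [] f) f
    (.loopTok_nil rfl ⟨rfl, fun h => ⟨?_, _, rfl, Iff.rfl⟩, fun h => ?_⟩)
  · simpa [Store.set, enc_nil] using hrun
  · simpa using f.wf_nil.1 h
  · simpa using mt f.wf_nil.2 h

theorem Runs.game {N : ℕ} (d : ℕ) (hms : ∀ k ∈ ms, 1 ≤ k)
    (hN : f.toks.length + (ms.flatMap unary).length + d + ms.length ≤ N) :
    Runs .qry (VAL (ms.length + d)) (.game d ms.length)
      { S with
        hdr := ms.flatMap unary, body := enc f.toks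
        aux := [], tmp := [], qry := [], rnd := [], bad := [], val := [] }
      ((ms.length + 1) * (200 * (N + 1) ^ 2)) (GameOutcome S ms f) := by
  have hN2 : N + 1 ≤ (N + 1) ^ 2 := Nat.le_self_pow two_ne_zero _
  induction ms generalizing d f with
  | nil => exact (Runs.game_zero d).mono (by simp only [List.length_nil]; omega)
  | cons m ms ih =>
    simp only [List.flatMap_cons, List.length_append, List.length_cons, length_unary] at hN ⊢
    set rest := (ms.length + 1) * (200 * (N + 1) ^ 2) with hrest
    have hm : (m + 1) * (100 * (N + 1)) ≤ 100 * (N + 1) ^ 2 :=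
      calc (m + 1) * (100 * (N + 1)) ≤ (N + 1) * (100 * (N + 1)) :=
            Nat.mul_le_mul_right _ (by omega)
        _ = 100 * (N + 1) ^ 2 := by ring
    refine Runs.mono (t := ((m + 1) * (100 * (N + 1)) + (rest + 27 * f.toks.length + 9)) + 1) ?_
      (by rw [Nat.succ_mul (ms.length + 1), ← hrest]; omega)
    have hms' := List.forall_mem_of_forall_mem_cons hms
    refine runs_push_iff.2 (Runs.seq
      (Runs.rounds (S := { S with bad := [], val := [] }) (N := N) hms' (by omega)) ?_)
    rintro _ ⟨f', hlen, hwf, hsat, rfl⟩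
    refine ((Runs.switch (u := rest) fun hs => ?_).mono (by omega)).imp fun S' hS' =>
      hS'.congr hwf hsat
    have hlen' : (XExpr.neg f'.shift).toks.length ≤ f'.toks.length + 1 := by
      rw [XExpr.toks, ← f'.shiftToks_eq hs, List.length_cons]
      exact Nat.succ_le_succ f'.length_shiftToks_le
    have hrun := ih (f := .neg f'.shift) (d + 1) hms' (by omega)
    rwa [← Nat.add_assoc, Nat.add_right_comm] at hrun

end Game

/-! ### Reading instances -/

/-- The state with the word `l` on the input stack, all other stacks being empty. -/
def Store.input (l : List Bool) : Store := ⟨l, [], [], [], [], [], [], [], [], [], []⟩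

/-- The output in the state `S` is the truth value of `P`. -/
def Store.Decides (S : Store) (P : Prop) : Prop := ∃ c, S.out = [c] ∧ (c = true ↔ P)

theorem weakReduces_of_runs_input {φ₁ φ₂ : PromiseProblem} (p : Prog Stk) (T : Polynomial ℕ)
    (h : ∀ x : Word, Runs .qry φ₂ p (Store.input x.1) (T.eval x.1.length)
      fun S => ∃ b ∈ (φ₁ x : Set Bool), S.out = [b]) : WeakReduces φ₁ φ₂ := by
  refine weakReduces_of_runs .inp .out .qry p T (fun x => Store.input x.1) (fun x => ?_) h
  funext k
  cases k <;> rfl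

theorem HeaderOf.unique {n : ℕ} {l r r' : List Bool} {sizes sizes' : List ℕ}
    (h : HeaderOf n l sizes r) (h' : HeaderOf n l sizes' r') : sizes = sizes' ∧ r = r' :=
  flatMap_unary_append_inj (h.1.trans h'.1.symm) (h.2.2.symm.trans h'.2.2)

theorem Instance.headerOf {n : ℕ} (I : Instance n) : HeaderOf n I.encode I.sizes I.expr.encode :=
  ⟨I.length_sizes, I.one_le_sizes, rfl⟩

theorem SAT_eq_true_iff {n : ℕ} {w : Word} :
    SAT n w = true ↔ ∃ sizes r, HeaderOf n w.1 sizes r ∧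
      ∃ e : BoolExpr, r = e.encode ∧ e.WellFormed sizes ∧ Sat sizes e.eval := by
  simp only [SAT, decide_eq_true_iff]
  constructor
  · rintro ⟨I, hI, hs⟩
    exact ⟨_, _, hI ▸ I.headerOf, I.expr, rfl, I.wellFormed, hs⟩
  · rintro ⟨sizes, _, ⟨hl, h1, hw⟩, e, rfl, he, hs⟩
    exact ⟨⟨sizes, e, hl, h1, he⟩, hw.symm, hs⟩

theorem SAT_encode {n : ℕ} (I : Instance n) {w : Word} (h : I.encode = w.1) :
    SAT n w = true ↔ Sat I.sizes I.fn := by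
  simp only [SAT, decide_eq_true_iff]
  refine ⟨?_, fun hI => ⟨I, h, hI⟩⟩
  rintro ⟨J, hJ, hs⟩
  rwa [Instance.encode_injective (h.trans hJ.symm)]

theorem VAL_eq_univ {n : ℕ} {w : Word} (h : ∀ I : Instance n, I.encode ≠ w.1) :
    (VAL n w : Set Bool) = Set.univ := by
  rw [VAL, dif_neg]
  rintro ⟨I, hI⟩
  exact h I hI

/-- Run `p`, but with the output `0` instead if an error has been recorded. -/
def Prog.rejectIfBad (p : Prog Stk) : Prog Stk := pop .bad fun
  | some _ => push .out false skip
  | none => p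

theorem Runs.rejectIfBad_of_bad_eq_nil {φ : PromiseProblem} {p : Prog Stk} {S : Store} {t : ℕ}
    {Q : Store → Prop} (hbad : S.bad = []) (h : Runs .qry φ p S t Q) :
    Runs .qry φ (.rejectIfBad p) S (t + 1) Q := by
  obtain ⟨inp, qry, hdr, tmp, body, aux, bad, val, grd, rnd, out⟩ := S
  obtain rfl : bad = [] := hbad
  exact runs_pop_iff.2 h

theorem Runs.rejectIfBad_of_bad_ne_nil {φ : PromiseProblem} {p : Prog Stk} {S : Store}
    (hbad : S.bad ≠ []) (hout : S.out = []) :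
    Runs .qry φ (.rejectIfBad p) S 3 (·.out = [false]) := by
  obtain ⟨inp, qry, hdr, tmp, body, aux, bad, val, grd, rnd, out⟩ := S
  obtain rfl : out = [] := hout
  obtain ⟨b, B, rfl⟩ := List.exists_cons_of_ne_nil hbad
  exact runs_pop_iff.2 (runs_push_iff.2 (runs_skip_iff.2 rfl))

theorem Store.Decides.congr {S : Store} {P P' : Prop} (h : S.Decides P) (hP : P ↔ P') :
    S.Decides P' :=
  propext hP ▸ h

theorem Store.decides_of_not {S : Store} {P : Prop} (hP : ¬ P) (h : S.out = [false]) :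
    S.Decides P :=
  ⟨false, h, by simp [hP]⟩

/-! ### Reducing `SATₙ` to `VALₙ` -/

namespace Prog

/-- Decide whether the game with `n` blocks is won, the tokens of the expression being on `aux`. -/
def decideGame (n : ℕ) : Prog Stk :=
  seq (moveTok .aux .body) <| seq (game 0 n) <| rejectIfBad <|
    pop .val fun o => push .out (o.getD false) skip

/-- Read the expression of an instance of `SATₙ` and solve the instance, the block sizes being on
`tmp`. -/
def decideBody (n : ℕ) : Prog Stk :=
  seq (move .tmp .hdr) <| push .val true <| seq parseExprs <| rejectIfBad <| pop .inp fun
    | some _ => push .out false skip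
    | none => decideGame n

/-- Solve `SATₙ` with an oracle for `VALₙ`. -/
def satProg (n : ℕ) : Prog Stk := seq (parseHeader n) (rejectIfBad (decideBody n))

end Prog

theorem GameOutcome.runs_output {φ : PromiseProblem} {S S' : Store} {ms : List ℕ} {f : XExpr}
    (h : GameOutcome S ms f S') (hout : S.out = []) :
    Runs .qry φ (.rejectIfBad (.pop .val fun o => .push .out (o.getD false) .skip)) S' 4
      (·.Decides (f.WF ms ∧ Sat ms f.eval)) := by
  obtain ⟨ho, hwin, herr⟩ := h
  by_cases hf : f.WF ms
  · obtain ⟨hbad, c, hval, hc⟩ := hwin hf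
    refine Runs.rejectIfBad_of_bad_eq_nil hbad
      (runs_pop_iff.2 (runs_push_iff.2 (runs_skip_iff.2 ⟨c, ?_, by simp [hf, hc]⟩)))
    simp [stack, setStack, Store.get, Store.set, hval, ho, hout]
  · exact ((Runs.rejectIfBad_of_bad_ne_nil (herr hf) (ho.trans hout)).mono (by omega)).imp
      fun _ => Store.decides_of_not fun h => hf h.1

theorem Runs.decideGame {ms : List ℕ} {f : XExpr} {N : ℕ} (hms : ∀ k ∈ ms, 1 ≤ k)
    (hN : f.toks.length + (ms.flatMap unary).length + ms.length ≤ N) :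
    Runs .qry (VAL ms.length) (.decideGame ms.length)
      { Store.input [] with hdr := ms.flatMap unary, aux := enc f.toks.reverse }
      (7 * f.toks.length + (ms.length + 1) * (200 * (N + 1) ^ 2) + 5)
      (·.Decides (f.WF ms ∧ Sat ms f.eval)) := by
  refine Runs.mono (t := (7 * f.toks.reverse.length + 1) +
    ((ms.length + 1) * (200 * (N + 1) ^ 2) + 4)) ?_ (by rw [List.length_reverse]; omega)
  refine Runs.seq_eq (.moveTok (by decide) f.toks.reverse [] rfl rfl) ?_
  refine Runs.seq (R := GameOutcome (Store.input []) ms f) ?_ fun S hS => hS.runs_output rfl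
  have hrun := Runs.game (S := Store.input []) 0 hms hN
  simpa [stack, setStack, Store.set, Store.input] using hrun

theorem XExpr.length_toks_ofBool_le (e : BoolExpr) : (ofBool e).toks.length ≤ e.encode.length := by
  induction e <;> simp_all [ofBool, toks, BoolExpr.encode, bitToks] <;> omega

theorem BoolExpr.encode_injective : Function.Injective BoolExpr.encode := fun e e' h =>
  (BoolExpr.encode_append_inj e e' (congrArg (· ++ []) h)).1

theorem Runs.decideGame_ofBool {ms : List ℕ} {e : BoolExpr} {N : ℕ} (hms : ∀ k ∈ ms, 1 ≤ k)
    (hN : e.encode.length + (ms.flatMap unary).length + ms.length ≤ N) :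
    Runs .qry (VAL ms.length) (.decideGame ms.length)
      { Store.input [] with hdr := ms.flatMap unary, aux := enc (forestToks [e]).reverse }
      (7 * e.encode.length + (ms.length + 1) * (200 * (N + 1) ^ 2) + 5)
      (·.Decides (e.WellFormed ms ∧ Sat ms fun ys => e.eval ys)) := by
  have htoks := XExpr.length_toks_ofBool_le e
  have hrun := Runs.decideGame (f := .ofBool e) (N := N) hms (by omega)
  simp only [XExpr.wf_ofBool, funext (XExpr.eval_ofBool e)] at hrun
  simpa [forestToks] using hrun.mono (by omega)

theorem Runs.decideBody {sizes : List ℕ} {r : List Bool} (hms : ∀ k ∈ sizes, 1 ≤ k) {L : ℕ}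
    (hL : (sizes.flatMap unary).length + r.length = L) :
    Runs .qry (VAL sizes.length) (.decideBody sizes.length)
      { Store.input r with tmp := (sizes.flatMap unary).reverse }
      (110 * L + (sizes.length + 1) * (200 * (L + sizes.length + 1) ^ 2) + 20)
      (·.Decides (∃ e : BoolExpr, r = e.encode ∧ e.WellFormed sizes ∧ Sat sizes e.eval)) := by
  set G := (sizes.length + 1) * (200 * (L + sizes.length + 1) ^ 2)
  refine Runs.mono (t := (3 * L + 1) + ((100 * r.length + 10 * 1 + 1) +
    (7 * L + G + 5 + 1 + 1) + 1)) ?_ (by omega)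
  refine Runs.seq_eq (.move (by decide) L ?_) (runs_push_iff.2 ?_)
  · simp only [stack, Store.get, List.length_reverse]
    omega
  refine Runs.seq (R := ExprsOutcome { Store.input r with hdr := sizes.flatMap unary } 1 r []) ?_ ?_
  · have hrun := Runs.parseExprs (φ := VAL sizes.length)
      (S := { Store.input r with hdr := sizes.flatMap unary }) (c := 1) (l := r) (A := []) rfl
    simpa [stack, setStack, Store.set, Store.get, Store.input, enc_nil] using hrun
  rintro S (⟨es, r', ⟨hes, rfl⟩, rfl⟩ | ⟨hno, hbad, hout⟩)
  swap
  · refine ((Runs.rejectIfBad_of_bad_ne_nil hbad hout).mono (by omega)).imp fun _ =>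
      Store.decides_of_not ?_
    rintro ⟨e, rfl, -⟩
    exact hno ⟨[e], [], rfl, by simp⟩
  obtain ⟨e, rfl⟩ := List.length_eq_one_iff.1 hes
  refine Runs.rejectIfBad_of_bad_eq_nil rfl (runs_pop_iff.2 ?_)
  rcases r' with _ | ⟨a, r'⟩
  · simp only [List.flatMap_cons, List.flatMap_nil, List.append_nil] at hL ⊢
    refine ((Runs.decideGame_ofBool (e := e) (N := L + sizes.length) hms (by omega)).mono
      (by omega)).imp fun _ hS => hS.congr ?_
    exact ⟨fun h => ⟨e, rfl, h⟩, fun ⟨e', he, h⟩ => BoolExpr.encode_injective he ▸ h⟩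
  · refine Runs.mono (t := 1 + 1) ?_ (by omega : 1 + 1 ≤ 7 * L + G + 5)
    refine runs_push_iff.2 (runs_skip_iff.2 (Store.decides_of_not ?_ rfl))
    rintro ⟨e', he, -⟩
    exact absurd (BoolExpr.encode_append_inj e e' (s := []) (by simpa using he)).2
      (List.cons_ne_nil _ _)

theorem Runs.satProg (n : ℕ) (x : Word) :
    Runs .qry (VAL n) (.satProg n) (Store.input x.1)
      (30 * n + 130 * x.1.length + 40 + (n + 1) * (200 * (x.1.length + n + 1) ^ 2))
      (·.Decides (SAT n x = true)) := by
  set L := x.1.length with hL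
  set G := (n + 1) * (200 * (L + n + 1) ^ 2) with hG
  refine Runs.mono (t := (20 * L + 30 * n + 1) + (110 * L + G + 20 + 1)) ?_ (by omega)
  refine Runs.seq (Runs.parseHeader (S := Store.input []) (D := []) rfl rfl) ?_
  rintro S (⟨sizes, r, hhead, rfl⟩ | ⟨hno, hbad, hout⟩)
  · refine Runs.rejectIfBad_of_bad_eq_nil rfl ?_
    obtain ⟨rfl, hms, hx⟩ := id hhead
    rw [hx, List.length_append] at hL
    have hrun := Runs.decideBody hms hL.symm
    rw [← List.append_nil (sizes.flatMap unary).reverse] at hrun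
    refine hrun.imp fun S hS => hS.congr ?_
    rw [SAT_eq_true_iff]
    refine ⟨fun he => ⟨sizes, r, hhead, he⟩, ?_⟩
    rintro ⟨sizes', r', hhead', he⟩
    obtain ⟨rfl, rfl⟩ := hhead.unique hhead'
    exact he
  · refine ((Runs.rejectIfBad_of_bad_ne_nil hbad hout).mono (by omega)).imp fun _ =>
      Store.decides_of_not ?_
    rw [SAT_eq_true_iff]
    rintro ⟨sizes, r, h, -⟩
    exact hno ⟨sizes, r, h⟩

theorem weakReduces_SAT_VAL (n : ℕ) : WeakReduces (SAT n).toPromise (VAL n) := by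
  refine weakReduces_of_runs_input (.satProg n) (30 * Polynomial.C n + 130 * Polynomial.X + 40 +
    (Polynomial.C n + 1) * (200 * (Polynomial.X + Polynomial.C n + 1) ^ 2)) fun x => ?_
  refine ((Runs.satProg n x).mono (by simp)).imp ?_
  rintro S ⟨c, hout, hc⟩
  exact ⟨c, Bool.eq_iff_iff.2 hc, hout⟩

/-! ### Reducing `VALₙ` to `SATₙ` -/

/-- The first variable of the first block. -/
def firstVar : BoolExpr := .var 0 0

theorem sat_firstVar_and_iff {ms : List ℕ} {f : List (List Bool) → Bool} :
    Sat ms (fun ys => firstVar.eval ys && f ys) ↔ true ∈ firstBits ms f := by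
  rcases ms with _ | ⟨m, ms⟩
  · simp [Sat, firstBits, witnesses, firstVar, BoolExpr.eval]
  constructor
  · rintro ⟨_ | ⟨_ | _, x⟩, hx, hc⟩
    · exact absurd hc (by simpa [firstVar, BoolExpr.eval] using (sat_coSat_const ms false).2)
    · exact absurd hc (by simpa [firstVar, BoolExpr.eval] using (sat_coSat_const ms false).2)
    · exact ⟨true :: x, ⟨hx, by simpa [firstVar, BoolExpr.eval] using hc⟩, rfl⟩
  · rintro ⟨x, ⟨hx, hc⟩, hxb⟩
    obtain ⟨y, rfl⟩ := List.head?_eq_some_iff.mp hxb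
    exact ⟨true :: y, hx, by simpa [firstVar, BoolExpr.eval] using hc⟩

/-- The restriction of a function to the words with first letter `1`. -/
def Instance.restrict {n : ℕ} (I : Instance n) (hn : n ≠ 0) : Instance n where
  sizes := I.sizes
  expr := .and firstVar I.expr
  length_sizes := I.length_sizes
  one_le_sizes := I.one_le_sizes
  wellFormed := by
    obtain ⟨_ | ⟨m, ms⟩, f, hl, h1, hw⟩ := I
    · exact absurd hl.symm hn
    · exact ⟨h1 m List.mem_cons_self, hw⟩

theorem Instance.mem_val_of_restrict {n : ℕ} (I : Instance n) (hn : n ≠ 0) {b : Bool}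
    (hb : b = true ↔ Sat (I.restrict hn).sizes (I.restrict hn).fn) : b ∈ (I.val : Set Bool) := by
  replace hb : b = true ↔ true ∈ firstBits I.sizes I.fn := hb.trans sat_firstVar_and_iff
  rw [Instance.val]
  split
  case isTrue h =>
    obtain ⟨c, hc⟩ := firstBits_nonempty I hn h.2
    cases b <;> cases c <;> simp_all
  case isFalse => exact Set.mem_univ b

theorem SAT_mem_VAL {n : ℕ} (hn : n ≠ 0) {x w : Word} {sizes : List ℕ} {r : List Bool}
    (hx : HeaderOf n x.1 sizes r)
    (hw : w.1 = sizes.flatMap unary ++ ([false, true] ++ firstVar.encode ++ r)) :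
    SAT n w ∈ (VAL n x : Set Bool) := by
  by_cases hI : ∃ I : Instance n, I.encode = x.1
  · obtain ⟨I, hI⟩ := hI
    obtain ⟨rfl, rfl⟩ := hx.unique (hI ▸ I.headerOf)
    rw [VAL_encode I x hI]
    exact I.mem_val_of_restrict hn (SAT_encode (I.restrict hn) hw.symm)
  · rw [VAL_eq_univ fun I h => hI ⟨I, h⟩]
    exact Set.mem_univ _

namespace Prog

/-- Ask whether there is a solution with first letter `1`, the block sizes being on `tmp`. -/
def askFirstVar : Prog Stk :=
  pushList .tmp (firstVar.encode.reverse ++ [true, false]) <| seq (move .inp .tmp) <|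
    seq (move .tmp .qry) <| ask fun b => push .out b skip

/-- Solve `VALₙ` with an oracle for `SATₙ`. -/
def valProg (n : ℕ) : Prog Stk := seq (parseHeader n) (rejectIfBad askFirstVar)

end Prog

theorem Runs.askFirstVar {φ : Problem} {h r : List Bool} {L : ℕ} (hL : h.length + r.length = L)
    {w : Word} (hw : w.1 = h ++ ([false, true] ++ firstVar.encode ++ r)) :
    Runs .qry φ.toPromise .askFirstVar { Store.input r with tmp := h.reverse }
      (6 * L + 40) (·.out = [φ w]) := by
  refine Runs.mono (t := (3 * L + 1) + ((3 * (L + 6) + 1) + 3) + 6) ?_ (by omega)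
  refine Runs.pushList (Runs.seq_eq (.move (by decide) L ?_)
    (Runs.seq_eq (.move (by decide) (L + 6) ?_) ?_))
  · simp [stack, setStack, Store.set, Store.get, Store.input]
    omega
  · simp [stack, setStack, Store.set, Store.get, Store.input, firstVar, BoolExpr.encode, unary]
    omega
  · refine .ask w ?_ fun b hb => runs_push_iff.2 (runs_skip_iff.2 ?_)
    · simp [stack, setStack, Store.set, Store.get, Store.input, hw]
    · obtain rfl : b = φ w := hb
      rfl

theorem Runs.valProg {n : ℕ} (hn : n ≠ 0) (x : Word) :
    Runs .qry (SAT n).toPromise (.valProg n) (Store.input x.1) (30 * n + 30 * x.1.length + 50)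
      fun S => ∃ b ∈ (VAL n x : Set Bool), S.out = [b] := by
  set L := x.1.length with hL
  refine Runs.mono (t := (20 * L + 30 * n + 1) + (6 * L + 40 + 1)) ?_ (by omega)
  refine Runs.seq (Runs.parseHeader (S := Store.input []) (D := []) rfl rfl) ?_
  rintro S (⟨sizes, r, hhead, rfl⟩ | ⟨hno, hbad, hout⟩)
  · let w : Word := ⟨sizes.flatMap unary ++ ([false, true] ++ firstVar.encode ++ r), by simp⟩
    rw [hhead.2.2, List.length_append] at hL
    refine Runs.rejectIfBad_of_bad_eq_nil rfl ?_
    have hrun := Runs.askFirstVar (φ := SAT n) hL.symm (w := w) rfl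
    refine Runs.imp (s := _) ?_ fun S hS => ⟨SAT n w, SAT_mem_VAL hn hhead rfl, hS⟩
    simpa [Store.input] using hrun
  · refine ((Runs.rejectIfBad_of_bad_ne_nil hbad hout).mono (by omega)).imp fun S hS =>
      ⟨false, ?_, hS⟩
    rw [VAL_eq_univ fun I hI => hno ⟨_, _, hI ▸ I.headerOf⟩]
    exact Set.mem_univ false

theorem weakReduces_VAL_SAT {n : ℕ} (hn : n ≠ 0) : WeakReduces (VAL n) (SAT n).toPromise :=
  weakReduces_of_runs_input (.valProg n) (30 * Polynomial.C n + 30 * Polynomial.X + 50) fun x =>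
    (Runs.valProg hn x).mono (by simp)

theorem VAL_mem_VHat (n : ℕ) : VAL n ∈ VHat n :=
  ⟨id, ⟨Turing.idComputableInPolyTime _⟩, fun _ => subset_rfl⟩

end PromiseHierarchy

theorem theorem11 (n : ℕ) (hn : 1 ≤ n) :
    weakClosureOfClass (VHat n) = DeltaHat (n + 1) ∧
      weakClosure (VAL n) = DeltaHat (n + 1) := by
  have hVAL : WeakReduces (VAL n) (SAT n).toPromise :=
    weakReduces_VAL_SAT (Nat.one_le_iff_ne_zero.1 hn)
  have h : weakClosure (VAL n) = DeltaHat (n + 1) :=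
    Set.Subset.antisymm (fun _ hφ => hφ.trans hVAL) fun _ hφ => hφ.trans (weakReduces_SAT_VAL n)
  refine ⟨Set.Subset.antisymm ?_ ?_, h⟩
  · rintro φ ⟨ψ, hψ, hφ⟩
    exact (hφ.trans (StrongReduces.weakReduces hψ)).trans hVAL
  · exact h ▸ fun φ hφ => ⟨VAL n, VAL_mem_VHat n, hφ⟩
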